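/- All graphs are finite and simple, and $\tau=\frac{1+\sqrt5}{2}$. A \emph{Hoffman graph} $\mathfrak H$ is a graph with at least one vertex, whose vertices are labelled slim or fat, such that every fat vertex has a slim neighbour and fat vertices are pairwise non-adjacent; it is \emph{fat} if every slim vertex has a fat neighbour. Write $V^s(\mathfrak H)$ for the set of slim vertices and $N^f(x)$ for the set of fat neighbours of $x$. If $\begin{pmatrix}A_s&C\\C^T&0\end{pmatrix}$ is the adjacency matrix (slim vertices first), $\lambda_{\min}(\mathfrak H)$ is the smallest eigenvalue of $A_s-CC^T$. A \emph{decomposition} of $\mathfrak H$ is a family $\mathfrak H^1,\dots,\mathfrak H^n$ of induced Hoffman subgraphs whose vertex sets cover $\mathfrak H$, whose slim vertex sets are pairwise disjoint, such that each $\mathfrak H^i$ contains all fat neighbours of its slim vertices, and such that for slim $x\in\mathfrak H^i$, $y\in\mathfrak H^j$ with $i\ne j$ one has $|N^f(x)\cap N^f(y)|\le 1$, with equality if and only if $x,y$ are adjacent. For $\alpha<0$ and $\lambda_{\min}(\mathfrak H)\ge\alpha$, $\mathfrak H$ is \emph{$\alpha$-reducible} if it is an induced Hoffman subgraph of a Hoffman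 graph having a decomposition $\{\mathfrak H^1,\mathfrak H^2\}$ with $\lambda_{\min}(\mathfrak H^i)\ge\alpha$ and $V^s(\mathfrak H^i)\cap V^s(\mathfrak H)\neq\emptyset$ for $i=1,2$; it is \emph{$\alpha$-irreducible} if $\lambda_{\min}(\mathfrak H)\ge\alpha$ and it is not $\alpha$-reducible. The \emph{special graph} $\mathcal S(\mathfrak H)$ is the edge-signed graph on $V^s(\mathfrak H)$ in which distinct $u,v$ form a $(+)$-edge if they are adjacent and $N^f(u)\cap N^f(v)=\emptyset$, and a $(-)$-edge if they are non-adjacent and $N^f(u)\cap N^f(v)\ne\emptyset$. For $p+q\le r$, $\mathcal Q_{p,q,r}$ is the edge-signed graph consisting of a clique on $r$ vertices, all of whose edges are $(+)$-edges, with one pendant vertex attached by a $(+)$-edge to each of $p$ of these vertices and one pendant vertex attached by a $(-)$-edge to each of $q$ others. The $15$ exceptional edge-signed graphs are: \begin{itemize} \item $\mathcal S_{3,1}$: the path with signs $--$; $\mathcal S_{4,1},\mathcal S_{4,2},\mathcal S_{4,3}$: the paths with signs $---$, $+--$, $+-+$; $\mathcal S_{4,4}$: the $4$-cycle with exactly one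 $(-)$-edge; $\mathcal S_{5,2}$, $\mathcal S_{5,3}$: the $5$-cycles with exactly two $(-)$-edges, consecutive and non-consecutive, respectively; \item with only $(+)$-edges: $\mathcal S_{4,5}$, $K_4$ minus an edge; $\mathcal S_{5,1}$, the $5$-cycle; $\mathcal S_{5,4}$, the gem (a $4$-vertex path plus a vertex joined to all of it); $\mathcal S_{5,5}$, two triangles sharing a vertex; $\mathcal S_{6,1}$, the wheel ($5$-cycle plus a vertex joined to all of it); $\mathcal S_{6,2}$, the $3$-sun (a triangle with a further triangle glued on each of its three edges); $\mathcal S_{6,3}$, a $K_4$ and a triangle sharing a vertex; \item $\mathcal S_{5,6}$: $K_4$ minus an edge, all edges $(+)$, plus a fifth vertex joined only to the two ends of the missing edge, to one by a $(+)$-edge and to the other by a $(-)$-edge. \end{itemize} Then the following hold. (1) If $\mathfrak H$ is a fat $(-1-\tau)$-irreducible Hoffman graph, then $\mathcal S(\mathfrak H)$ is isomorphic to $\mathcal Q_{0,0,1}$, $\mathcal Q_{1,0,1}$, $\mathcal Q_{0,1,1}$, or one of the $15$ exceptional edge-signed graphs. (2) If $\mathfrak H$ is a Hoffman graph in which every slim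 vertex has exactly one fat neighbour and $\mathcal S(\mathfrak H)\cong\mathcal Q_{p,q,r}$ with $p+q\le r$ and $r\ge2$, then $\mathfrak H$ is $(-1-\tau)$-reducible (in particular $\lambda_{\min}(\mathfrak H)\ge-1-\tau$). -/

import Mathlib

universe u v

/-- A Hoffman graph on the vertex set `V`: a graph together with a labelling of its vertices as
fat or slim (`fat` is the set of fat vertices, its complement is the set of slim vertices), such
that every fat vertex has a slim neighbour and fat vertices are pairwise non-adjacent. -/
structure HoffmanGraph (V : Type u) where
  graph : SimpleGraph V
  fat : Set V
  exists_slim_adj : ∀ x ∈ fat, ∃ y, y ∉ fat ∧ graph.Adj x y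
  fat_not_adj : ∀ x ∈ fat, ∀ y ∈ fat, ¬ graph.Adj x y

/-- An edge-signed graph on the vertex set `V`, given by its graph `pos` of `(+)`-edges and its
graph `neg` of `(-)`-edges; no pair of vertices carries both signs. -/
structure EdgeSignedGraph (V : Type u) where
  pos : SimpleGraph V
  neg : SimpleGraph V
  disjoint : Disjoint pos neg

namespace EdgeSignedGraph

/-- Isomorphism of edge-signed graphs: a bijection of the vertices preserving `(+)`-edges and
`(-)`-edges in both directions. -/
def Isomorphic {V : Type u} {W : Type v} (S : EdgeSignedGraph V) (T : EdgeSignedGraph W) : Prop :=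
  ∃ φ : V ≃ W, ∀ x y, (S.pos.Adj x y ↔ T.pos.Adj (φ x) (φ y)) ∧
    (S.neg.Adj x y ↔ T.neg.Adj (φ x) (φ y))

/-- The edge-signed graph with the given `(+)`-edges and `(-)`-edges (a pair occurring in both
lists would count as a `(+)`-edge; no such pair occurs below). -/
def ofEdges {n : ℕ} (P N : List (Fin n × Fin n)) : EdgeSignedGraph (Fin n) where
  pos := SimpleGraph.fromRel fun i j => (i, j) ∈ P
  neg := (SimpleGraph.fromRel fun i j => (i, j) ∈ N) \ SimpleGraph.fromRel fun i j => (i, j) ∈ P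
  disjoint := disjoint_sdiff_self_right

/-- The `(+)`-edges of `Q p q r`, on the vertex set `V_p ⊔ V_q ⊔ V_r`: all pairs inside `V_r`, and
the perfect matching between `V_p` and the set `U_p` of the first `p` vertices of `V_r`. -/
def QPos (p q r : ℕ) : Fin p ⊕ Fin q ⊕ Fin r → Fin p ⊕ Fin q ⊕ Fin r → Prop
  | .inr (.inr k), .inr (.inr l) => k ≠ l
  | .inr (.inr k), .inl i => (k : ℕ) = i
  | _, _ => False

/-- The `(-)`-edges of `Q p q r`: the perfect matching between `V_q` and the set `U_q` of the
`q` vertices of `V_r` that follow those of `U_p`. -/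
def QNeg (p q r : ℕ) : Fin p ⊕ Fin q ⊕ Fin r → Fin p ⊕ Fin q ⊕ Fin r → Prop
  | .inr (.inr k), .inr (.inl j) => (k : ℕ) = p + j
  | _, _ => False

/-- The edge-signed graph `Q_{p,q,r}` (meant for `p + q ≤ r`): a clique on `r` vertices with all
edges positive, with a pendant `(+)`-edge attached to `p` of its vertices and a pendant `(-)`-edge
attached to `q` other ones. -/
def Q (p q r : ℕ) : EdgeSignedGraph (Fin p ⊕ Fin q ⊕ Fin r) where
  pos := SimpleGraph.fromRel (QPos p q r)
  neg := SimpleGraph.fromRel (QNeg p q r)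
  disjoint := by
    rw [SimpleGraph.disjoint_left]
    rintro (a | a | a) (b | b | b) <;> simp [QPos, QNeg]

/-! The fifteen exceptional edge-signed graphs. -/

/-- The path with signs `- -`. -/
def S31 : EdgeSignedGraph (Fin 3) := ofEdges [] [(0, 1), (1, 2)]

/-- The path with signs `- - -`. -/
def S41 : EdgeSignedGraph (Fin 4) := ofEdges [] [(0, 1), (1, 2), (2, 3)]

/-- The path with signs `+ - -`. -/
def S42 : EdgeSignedGraph (Fin 4) := ofEdges [(0, 1)] [(1, 2), (2, 3)]

/-- The path with signs `+ - +`. -/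
def S43 : EdgeSignedGraph (Fin 4) := ofEdges [(0, 1), (2, 3)] [(1, 2)]

/-- The 4-cycle with exactly one `(-)`-edge. -/
def S44 : EdgeSignedGraph (Fin 4) := ofEdges [(0, 1), (1, 2), (0, 3)] [(2, 3)]

/-- The all-positive complete graph on four vertices minus an edge. -/
def S45 : EdgeSignedGraph (Fin 4) := ofEdges [(0, 1), (1, 2), (0, 3), (1, 3), (2, 3)] []

/-- The all-positive 5-cycle. -/
def S51 : EdgeSignedGraph (Fin 5) := ofEdges [(0, 1), (1, 2), (2, 3), (3, 4), (0, 4)] []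

/-- The 5-cycle with exactly two `(-)`-edges, which are consecutive. -/
def S52 : EdgeSignedGraph (Fin 5) := ofEdges [(0, 1), (1, 2), (2, 3)] [(3, 4), (0, 4)]

/-- The 5-cycle with exactly two `(-)`-edges, which are not consecutive. -/
def S53 : EdgeSignedGraph (Fin 5) := ofEdges [(0, 1), (1, 2), (3, 4)] [(2, 3), (0, 4)]

/-- The all-positive gem: a path on four vertices and a fifth vertex joined to all of them. -/
def S54 : EdgeSignedGraph (Fin 5) :=
  ofEdges [(0, 1), (1, 2), (2, 3), (0, 4), (1, 4), (2, 4), (3, 4)] []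

/-- The all-positive butterfly: two triangles sharing a vertex. -/
def S55 : EdgeSignedGraph (Fin 5) :=
  ofEdges [(0, 1), (0, 4), (1, 4), (1, 2), (1, 3), (2, 3)] []

/-- The all-positive complete graph on four vertices minus an edge, with a fifth vertex joined to
the ends of the missing edge, to one by a `(+)`-edge and to the other by a `(-)`-edge. -/
def S56 : EdgeSignedGraph (Fin 5) :=
  ofEdges [(1, 2), (1, 3), (2, 3), (2, 4), (3, 4), (0, 1)] [(0, 4)]

/-- The all-positive wheel: a 5-cycle and a sixth vertex joined to all of it. -/
def S61 : EdgeSignedGraph (Fin 6) :=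
  ofEdges [(0, 1), (1, 2), (2, 3), (3, 4), (0, 4), (0, 5), (1, 5), (2, 5), (3, 5), (4, 5)] []

/-- The all-positive 3-sun: a triangle `{0, 1, 2}`, each of whose edges lies in one further
triangle. -/
def S62 : EdgeSignedGraph (Fin 6) :=
  ofEdges [(0, 1), (0, 2), (1, 2), (0, 3), (1, 3), (1, 4), (2, 4), (0, 5), (2, 5)] []

/-- The all-positive complete graph on four vertices and a triangle, sharing one vertex. -/
def S63 : EdgeSignedGraph (Fin 6) :=
  ofEdges [(1, 2), (1, 3), (1, 4), (2, 3), (2, 4), (3, 4), (0, 1), (0, 5), (1, 5)] []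

/-- The list of the fifteen exceptional edge-signed graphs. -/
def exceptional : List (Σ n : ℕ, EdgeSignedGraph (Fin n)) :=
  [⟨3, S31⟩, ⟨4, S41⟩, ⟨4, S42⟩, ⟨4, S43⟩, ⟨4, S44⟩, ⟨4, S45⟩, ⟨5, S51⟩, ⟨5, S52⟩, ⟨5, S53⟩,
    ⟨5, S54⟩, ⟨5, S55⟩, ⟨5, S56⟩, ⟨6, S61⟩, ⟨6, S62⟩, ⟨6, S63⟩]

end EdgeSignedGraph

namespace HoffmanGraph

variable {V : Type u}

/-- The set `N^f(x)` of fat neighbours of `x`. -/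
def fatNbrs (H : HoffmanGraph V) (x : V) : Set V := {y | y ∈ H.fat ∧ H.graph.Adj x y}

/-- A Hoffman graph is fat if every slim vertex has a fat neighbour. -/
def IsFat (H : HoffmanGraph V) : Prop := ∀ x, x ∉ H.fat → (H.fatNbrs x).Nonempty

open Classical in
/-- The block `A_s` of the adjacency matrix (slim rows, slim columns). -/
noncomputable def slimMatrix (H : HoffmanGraph V) :
    Matrix {x // x ∉ H.fat} {x // x ∉ H.fat} ℝ :=
  Matrix.of fun x y => if H.graph.Adj x y then 1 else 0

open Classical in
/-- The block `C` of the adjacency matrix (slim rows, fat columns). -/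
noncomputable def slimFatMatrix (H : HoffmanGraph V) :
    Matrix {x // x ∉ H.fat} {x // x ∈ H.fat} ℝ :=
  Matrix.of fun x y => if H.graph.Adj x y then 1 else 0

/-- The matrix `B(H) = A_s - C Cᵀ`. -/
noncomputable def B [Finite V] (H : HoffmanGraph V) :
    Matrix {x // x ∉ H.fat} {x // x ∉ H.fat} ℝ :=
  letI := Fintype.ofFinite {x // x ∈ H.fat}
  H.slimMatrix - H.slimFatMatrix * H.slimFatMatrix.transpose

/-- The smallest eigenvalue `λ_min(H)` of the real symmetric matrix `B(H)`. (The infimum is over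
a finite set, which is non-empty as soon as `H` has a vertex.) -/
noncomputable def lambdaMin [Finite V] (H : HoffmanGraph V) : ℝ :=
  letI := Fintype.ofFinite {x // x ∉ H.fat}
  sInf {c : ℝ | Module.End.HasEigenvalue H.B.mulVecLin c}

/-- A vertex subset induces a Hoffman graph exactly if each of its fat vertices keeps a slim
neighbour. -/
def IsHoffmanSet (H : HoffmanGraph V) (S : Set V) : Prop :=
  ∀ x ∈ S, x ∈ H.fat → ∃ y ∈ S, y ∉ H.fat ∧ H.graph.Adj x y

/-- The induced Hoffman subgraph on the vertex set `S`. -/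
def induce (H : HoffmanGraph V) (S : Set V) (hS : H.IsHoffmanSet S) : HoffmanGraph S where
  graph := H.graph.induce S
  fat := {x | (x : V) ∈ H.fat}
  exists_slim_adj := by
    rintro ⟨x, hx⟩ hf
    obtain ⟨y, hy, hyf, hxy⟩ := hS x hx hf
    exact ⟨⟨y, hy⟩, hyf, hxy⟩
  fat_not_adj := fun x hx y hy h => H.fat_not_adj x hx y hy h

/-- A decomposition of `H` into induced Hoffman subgraphs, given by their vertex sets `P i`. -/
structure IsDecomposition (H : HoffmanGraph V) {n : ℕ} (P : Fin n → Set V) : Prop where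
  isHoffmanSet : ∀ i, H.IsHoffmanSet (P i)
  cover : ∀ x, ∃ i, x ∈ P i
  slim_disjoint : ∀ i j, i ≠ j → ∀ x, x ∉ H.fat → x ∈ P i → x ∉ P j
  fat_mem : ∀ i, ∀ x ∈ P i, x ∉ H.fat → ∀ y ∈ H.fat, H.graph.Adj x y → y ∈ P i
  cross : ∀ i j, i ≠ j → ∀ x ∈ P i, x ∉ H.fat → ∀ y ∈ P j, y ∉ H.fat →
    (H.fatNbrs x ∩ H.fatNbrs y).ncard ≤ 1 ∧
      ((H.fatNbrs x ∩ H.fatNbrs y).ncard = 1 ↔ H.graph.Adj x y)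

/-- `H` is `α`-reducible: `λ_min(H) ≥ α`, and some finite Hoffman graph `H'` contains `H` as an
induced Hoffman subgraph and has a decomposition into two parts with smallest eigenvalue at least
`α`, each of which contains a slim vertex of `H`. -/
def IsReducible [Finite V] (H : HoffmanGraph V) (α : ℝ) : Prop :=
  α ≤ H.lambdaMin ∧
    ∃ (W : Type u) (_ : Finite W) (H' : HoffmanGraph W) (e : H.graph ↪g H'.graph)
      (P : Fin 2 → Set W) (hP : H'.IsDecomposition P),
      (∀ x, e x ∈ H'.fat ↔ x ∈ H.fat) ∧
      ∀ i, α ≤ (H'.induce (P i) (hP.isHoffmanSet i)).lambdaMin ∧ ∃ x, x ∉ H.fat ∧ e x ∈ P i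

/-- `H` is `α`-irreducible: `λ_min(H) ≥ α` and `H` is not `α`-reducible. -/
def IsIrreducible [Finite V] (H : HoffmanGraph V) (α : ℝ) : Prop :=
  α ≤ H.lambdaMin ∧ ¬ H.IsReducible α

/-- The special graph `S(H)` of a Hoffman graph: its vertices are the slim vertices of `H`. -/
def specialGraph (H : HoffmanGraph V) : EdgeSignedGraph {x // x ∉ H.fat} where
  pos :=
    { Adj := fun x y => x ≠ y ∧ H.graph.Adj x y ∧ H.fatNbrs x ∩ H.fatNbrs y = ∅
      symm := ⟨fun _ _ h => ⟨h.1.symm, h.2.1.symm, by rw [Set.inter_comm]; exact h.2.2⟩⟩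
      loopless := ⟨fun _ h => h.1 rfl⟩ }
  neg :=
    { Adj := fun x y => x ≠ y ∧ ¬ H.graph.Adj x y ∧ (H.fatNbrs x ∩ H.fatNbrs y).Nonempty
      symm := ⟨fun _ _ h => ⟨h.1.symm, fun h' => h.2.1 h'.symm,
        by rw [Set.inter_comm]; exact h.2.2⟩⟩
      loopless := ⟨fun _ h => h.1 rfl⟩ }
  disjoint := by
    rw [SimpleGraph.disjoint_left]
    exact fun _ _ h h' => h'.2.1 h.2.1

end HoffmanGraph

/-! Positive semidefiniteness of B(H) + (1+τ)I allows a slim vertex at most two fat neighbours.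
Irreducibility makes the graph of nonzero off-diagonal entries of B(H) connected, since a block
structure would decompose H itself (`IsIrreducible.exists_signEntry_ne_zero`). If x has two fat
neighbours and y is joined to x by a nonzero entry, the block of x, y has determinant τ(τ-1) - 1 =
0. Its null vector has an irrational ratio of coordinates and lies in the kernel of the whole
matrix, so the integral entries from other vertices to x and y vanish (`signEntry_of_two`), and S(H)
has at most two vertices.

Otherwise every slim vertex has one fat neighbour, and off the diagonal B(H) is the sign function σ
of S(H), with τI + σ positive semidefinite. Having the same fat neighbour is an equivalence
relation; negative edges run inside classes, positive edges between them. Connected functions of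
this kind are classified by adding one vertex at a time, testing the integral matrix 13I + 8σ
(`IsSignSystem.classification`). The search ends at six vertices as long as there is no positive K₄.
Around a maximal positive clique with at least four vertices, every outside vertex is attached to
exactly one clique vertex, and the result is a clique with pendant edges or contains S63
(`IsMaxClique.isPendantClique_or`).

Cliques with pendant edges are reducible: joining a new fat vertex to the clique subtracts an
all-ones block from B, which cancels the clique. What remains are blocks of size one, and of size
two with diagonal τ, τ-1 and off-diagonal entry ±1, hence determinant 0. The enlarged graph keeps
the eigenvalue bound and splits (`isReducible_of_isPendantClique`). This removes them from (1) and
is the content of (2). -/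

/-! ### Symmetric sign functions recorded along a list of vertices -/

/-- The strict upper triangle of the matrix of `σ` along a list of vertices. -/
def upperRows {α : Type*} (σ : α → α → ℤ) : List α → List (List ℤ)
  | [] => []
  | v :: vs => vs.map (σ v) :: upperRows σ vs

/-! ### Integral quadratic forms and fraction-free elimination -/

/-- The dot product of two lists. -/
def listDot : List ℤ → List ℤ → ℤ
  | a :: r, x :: xs => a * x + listDot r xs
  | _, _ => 0

/-- The quadratic form of the symmetric matrix with the given upper triangle (each row consisting
of its diagonal entry and the entries right of it). -/
def triForm : List (ℤ × List ℤ) → List ℤ → ℤ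
  | (p, r) :: M, x :: xs => p * x * x + 2 * x * listDot r xs + triForm M xs
  | _, _ => 0

/-- Each row of an upper triangle has as many entries as there are rows below it. -/
def IsTriangle : List (ℤ × List ℤ) → Prop
  | [] => True
  | (_, r) :: M => r.length = M.length ∧ IsTriangle M

/-- The fraction-free Schur complement of a pivot `a` with row `b`. -/
def schurStep (a : ℤ) : List ℤ → List (ℤ × List ℤ) → List (ℤ × List ℤ)
  | c :: b, (p, r) :: M =>
    (a * p - c * c, List.zipWith (fun m x => a * m - c * x) r b) :: schurStep a b M
  | _, _ => []

/-- A necessary condition for positive semidefiniteness: no negative pivot occurs in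
fraction-free elimination before the first zero pivot. -/
def pivotTest : ℕ → List (ℤ × List ℤ) → Bool
  | n + 1, (p, r) :: M =>
    match p with
    | Int.negSucc _ => false
    | Int.ofNat 0 => true
    | Int.ofNat (k + 1) => pivotTest n (schurStep (Int.ofNat (k + 1)) r M)
  | _, _ => true

lemma listDot_map_mul (a : ℤ) (r xs : List ℤ) :
    listDot r (xs.map (a * ·)) = a * listDot r xs := by
  induction r generalizing xs with
  | nil => simp [listDot]
  | cons c r ih =>
    cases xs with
    | nil => simp [listDot]
    | cons x xs => simp only [List.map_cons, listDot, ih]; ring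

lemma triForm_map_mul (a : ℤ) (M : List (ℤ × List ℤ)) (xs : List ℤ) :
    triForm M (xs.map (a * ·)) = a ^ 2 * triForm M xs := by
  induction M generalizing xs with
  | nil => simp [triForm]
  | cons c M ih =>
    cases xs with
    | nil => simp [triForm]
    | cons x xs => simp only [List.map_cons, triForm, ih, listDot_map_mul]; ring

lemma listDot_zipWith (a c : ℤ) (r b xs : List ℤ) (h : r.length = b.length) :
    listDot (List.zipWith (fun m x => a * m - c * x) r b) xs =
      a * listDot r xs - c * listDot b xs := by
  induction r generalizing b xs with
  | nil =>
    obtain rfl : b = [] := List.length_eq_zero_iff.1 h.symm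
    simp [listDot]
  | cons m r ih =>
    cases b with
    | nil => simp at h
    | cons y b =>
      cases xs with
      | nil => simp [listDot]
      | cons x xs =>
        simp only [List.zipWith_cons_cons, listDot]
        rw [ih b xs (by simpa using h)]
        ring

lemma length_schurStep (a : ℤ) (b : List ℤ) (M : List (ℤ × List ℤ)) (h : b.length = M.length) :
    (schurStep a b M).length = M.length := by
  induction M generalizing b with
  | nil => cases b <;> simp [schurStep]
  | cons c M ih =>
    cases b with
    | nil => simp at h
    | cons y b => simp [schurStep, ih b (by simpa using h)]

lemma IsTriangle.schurStep (a : ℤ) {b : List ℤ} {M : List (ℤ × List ℤ)} (hM : IsTriangle M)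
    (h : b.length = M.length) : IsTriangle (schurStep a b M) := by
  induction M generalizing b with
  | nil => cases b <;> simp [_root_.schurStep, IsTriangle]
  | cons c M ih =>
    cases b with
    | nil => simp at h
    | cons y b =>
      have hb : b.length = M.length := by simpa using h
      refine ⟨?_, ih hM.2 hb⟩
      rw [length_schurStep _ _ _ hb, List.length_zipWith, hM.1, hb, min_self]

/-- The Schur complement multiplied by the pivot, which keeps all entries integral. -/
lemma triForm_schurStep (a : ℤ) {b : List ℤ} {M : List (ℤ × List ℤ)} (hM : IsTriangle M)
    (h : b.length = M.length) (xs : List ℤ) (hxs : xs.length = M.length) :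
    triForm (schurStep a b M) xs = a * triForm M xs - listDot b xs ^ 2 := by
  induction M generalizing b xs with
  | nil =>
    obtain rfl : b = [] := List.length_eq_zero_iff.1 h
    simp [schurStep, triForm, listDot]
  | cons c M ih =>
    cases b with
    | nil => simp at h
    | cons y b =>
      cases xs with
      | nil => simp at hxs
      | cons x xs =>
        have hb : b.length = M.length := by simpa using h
        simp only [schurStep, triForm, listDot]
        rw [ih hM.2 hb xs (by simpa using hxs), listDot_zipWith _ _ _ _ _ (hM.1.trans hb.symm)]
        ring

lemma pivotTest_of_nonneg (n : ℕ) (M : List (ℤ × List ℤ)) (hM : IsTriangle M)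
    (h : ∀ xs : List ℤ, xs.length = M.length → 0 ≤ triForm M xs) : pivotTest n M = true := by
  induction n generalizing M with
  | zero => simp [pivotTest]
  | succ n ih =>
    match M with
    | [] => simp [pivotTest]
    | (Int.negSucc k, r) :: M =>
      -- The first unit vector; its zeros are written as multiples by 0 so that the scaling lemmas
      -- evaluate the form.
      have := h (1 :: (List.replicate M.length 1).map (0 * ·)) (by simp)
      simp only [triForm, listDot_map_mul, triForm_map_mul] at this
      have := Int.negSucc_lt_zero k
      linarith
    | (Int.ofNat 0, r) :: M => simp [pivotTest]
    | (Int.ofNat (k + 1), r) :: M =>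
      simp only [pivotTest]
      refine ih _ (hM.2.schurStep _ hM.1) fun xs hxs => ?_
      rw [length_schurStep _ _ _ hM.1] at hxs
      rw [triForm_schurStep _ hM.2 hM.1 _ hxs]
      set p : ℤ := Int.ofNat (k + 1)
      have hp : 0 < p := Int.natCast_succ_pos k
      -- Completing the square: with d the product of r and xs, the form takes the value p(p·Q(xs) -
      -- d²) here, which is p times the Schur complement at xs.
      have := h (-listDot r xs :: xs.map (p * ·)) (by simpa using hxs)
      simp only [triForm, listDot_map_mul, triForm_map_mul] at this
      refine nonneg_of_mul_nonneg_right (a := p) ?_ hp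
      linarith

/-- The upper triangle of `13 I + 8 σ`, where `g` is the strict upper triangle of `σ`. As
`13 / 8` is slightly more than the golden ratio `τ`, it is positive semidefinite if `τ I + σ` is. -/
def shiftedRows (g : List (List ℤ)) : List (ℤ × List ℤ) :=
  g.map fun r => (13, r.map (8 * ·))

lemma length_upperRows {α : Type*} (σ : α → α → ℤ) (vs : List α) :
    (upperRows σ vs).length = vs.length := by
  induction vs with
  | nil => rfl
  | cons v vs ih => simp [upperRows, ih]

lemma isTriangle_shiftedRows {α : Type*} (σ : α → α → ℤ) (vs : List α) :
    IsTriangle (shiftedRows (upperRows σ vs)) := by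
  induction vs with
  | nil => trivial
  | cons v vs ih =>
    refine ⟨?_, ih⟩
    simp [length_upperRows]

/-! ### The acceptance test for sign triangles -/

/-- Two `-1`s and one `1`. -/
def badTriple (c d e : ℤ) : Bool := c * d * e == 1 && c + d + e == -1

/-- The row `s` makes no bad triple with an entry of the triangle `g`. -/
def rowTripleTest : List ℤ → List (List ℤ) → Bool
  | c :: s, r :: g => (List.zipWith (badTriple c) s r).all (!·) && rowTripleTest s g
  | _, _ => true

/-- No triangle of `g` carries the signs `-, -, +`. -/
def tripleTest : List (List ℤ) → Bool
  | s :: g => rowTripleTest s g && tripleTest g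
  | [] => true

/-- The conjunction of the two tests. -/
def acceptRows (g : List (List ℤ)) : Bool := tripleTest g && pivotTest g.length (shiftedRows g)

lemma rowTripleTest_upperRows {α : Type*} (σ : α → α → ℤ)
    (h : ∀ x y z, badTriple (σ x y) (σ x z) (σ y z) = false) (v : α) (vs : List α) :
    rowTripleTest (vs.map (σ v)) (upperRows σ vs) = true := by
  induction vs with
  | nil => rfl
  | cons w vs ih =>
    simp only [List.map_cons, upperRows, rowTripleTest, ih, Bool.and_true, List.all_eq_true]
    intro b hb
    obtain ⟨i, hi, rfl⟩ := List.getElem_of_mem hb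
    simp [h]

/-- This test is not spectral: a triangle -, -, + is switching equivalent to the all-positive one,
so no eigenvalue bound excludes it. -/
lemma tripleTest_upperRows {α : Type*} (σ : α → α → ℤ)
    (h : ∀ x y z, badTriple (σ x y) (σ x z) (σ y z) = false) (vs : List α) :
    tripleTest (upperRows σ vs) = true := by
  induction vs with
  | nil => rfl
  | cons w vs ih => simp [upperRows, tripleTest, ih, rowTripleTest_upperRows σ h]

/-- The entries of the symmetric matrix with strict upper triangle `g`. -/
def rowsEntry (g : List (List ℤ)) (i j : ℕ) : ℤ :=
  if i < j then (g.getD i []).getD (j - i - 1) 0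
  else if j < i then (g.getD j []).getD (i - j - 1) 0 else 0

/-- Row i starts right of the diagonal, which shifts column j to position j - i - 1. -/
lemma upperRows_getD {α : Type*} (σ : α → α → ℤ) (vs : List α) (i j : ℕ) (hij : i < j)
    (hj : j < vs.length) :
    ((upperRows σ vs).getD i []).getD (j - i - 1) 0 = σ (vs[i]'(hij.trans hj)) vs[j] := by
  induction vs generalizing i j with
  | nil => simp at hj
  | cons v vs ih =>
    obtain ⟨j, rfl⟩ : ∃ k, j = k + 1 := ⟨j - 1, by omega⟩
    simp only [List.length_cons, Nat.add_lt_add_iff_right] at hj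
    cases i with
    | zero => simp [upperRows, hj]
    | succ i =>
      have := ih i j (by omega) hj
      simpa [upperRows] using this

lemma rowsEntry_upperRows {α : Type*} (σ : α → α → ℤ) (hσ : ∀ x y, σ x y = σ y x) (vs : List α)
    (i j : ℕ) (hi : i < vs.length) (hj : j < vs.length) (hij : i ≠ j) :
    rowsEntry (upperRows σ vs) i j = σ vs[i] vs[j] := by
  unfold rowsEntry
  rcases lt_or_gt_of_ne hij with h | h
  · rw [if_pos h, upperRows_getD σ vs i j h hj]
  · rw [if_neg h.not_gt, if_pos h, upperRows_getD σ vs j i h hi, hσ]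

/-! ### Enumeration of one-vertex extensions, and the tables -/

/-- All lists of distinct numbers below `n` along which `e` has the strict upper triangle `g`. -/
def copies (n : ℕ) (e : ℕ → ℕ → ℤ) : List (List ℤ) → List (List ℕ)
  | [] => [[]]
  | r :: g => (copies n e g).flatMap fun p =>
      ((List.range n).filter fun v => !p.contains v && p.map (e v) == r).map (· :: p)

/-- Only soundness of the enumeration matters: a successful `growthCheck` itself exhibits a copy. -/
lemma mem_copies {n : ℕ} {e : ℕ → ℕ → ℤ} {g : List (List ℤ)} {p : List ℕ}
    (hp : p ∈ copies n e g) : p.Nodup ∧ (∀ i ∈ p, i < n) ∧ upperRows e p = g := by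
  induction g generalizing p with
  | nil =>
    obtain rfl : p = [] := by simpa [copies] using hp
    simp [upperRows]
  | cons r g ih =>
    simp only [copies, List.mem_flatMap, List.mem_map, List.mem_filter, List.mem_range,
      Bool.and_eq_true, beq_iff_eq, Bool.not_eq_true', List.contains_eq_mem,
      decide_eq_false_iff_not] at hp
    obtain ⟨q, hq, w, ⟨hw, hwq, hr⟩, rfl⟩ := hp
    obtain ⟨h1, h2, h3⟩ := ih hq
    exact ⟨List.nodup_cons.2 ⟨hwq, h1⟩, by simpa [hw] using h2, by rw [upperRows, hr, h3]⟩

/-- All lists of length `n` with entries `0`, `1`, `-1`. -/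
def signLists : ℕ → List (List ℤ)
  | 0 => [[]]
  | n + 1 => (signLists n).flatMap fun s => [0 :: s, 1 :: s, -1 :: s]

lemma mem_signLists (s : List ℤ) (hs : ∀ a ∈ s, a = 0 ∨ a = 1 ∨ a = -1) :
    s ∈ signLists s.length := by
  induction s with
  | nil => simp [signLists]
  | cons a s ih =>
    simp only [List.length_cons, signLists, List.mem_flatMap]
    refine ⟨s, ih fun b hb => hs b (List.mem_cons_of_mem _ hb), ?_⟩
    rcases hs a List.mem_cons_self with rfl | rfl | rfl <;> simp

/-- Every acceptable extension of a triangle in `src` by a nonzero row contains a copy of a triangle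
in `tgt`. -/
def growthCheck (src tgt : List (List (List ℤ))) : Bool :=
  src.all fun g => (signLists g.length).all fun s =>
    s.all (· == 0) || (!acceptRows (s :: g) ||
      tgt.any fun g' => !(copies (g.length + 1) (rowsEntry (s :: g)) g').isEmpty)

/-- The all-positive complete graph on four vertices. -/
def rowsK4 : List (List ℤ) := [[1, 1, 1], [1, 1], [1], []]

/-- The all-positive `K₄` and triangle sharing one vertex. -/
def rowsS63 : List (List ℤ) := [[1, 0, 0, 0, 1], [1, 1, 1, 1], [1, 1, 0], [1, 0], [0], []]

/-- The triangle of one vertex. -/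
def rowsOne : List (List (List ℤ)) := [[[]]]

/-- The triangles of the two single edges. -/
def rowsTwo : List (List (List ℤ)) := [[[1], []], [[-1], []]]

/-- The exceptional ones on 3 vertices that contain no positive `K₄`. -/
def exceptionalRowsThree : List (List (List ℤ)) := [
    [[-1, 0], [-1], []]]

/-- The cliques with pendant edges on 3 vertices that contain no positive `K₄`. -/
def pendantRowsThree : List (List (List ℤ)) := [
    [[1, -1], [0], []],
    [[1, 1], [0], []],
    [[1, 1], [1], []]]

/-- The exceptional ones on 4 vertices that contain no positive `K₄`. -/
def exceptionalRowsFour : List (List (List ℤ)) := [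
    [[-1, 0, 0], [-1, 0], [-1], []],
    [[1, 0, 0], [-1, 0], [-1], []],
    [[1, 0, 0], [-1, 0], [1], []],
    [[1, 0, 1], [1, 0], [-1], []],
    [[1, 0, 1], [1, 1], [1], []]]

/-- The cliques with pendant edges on 4 vertices that contain no positive `K₄`. -/
def pendantRowsFour : List (List (List ℤ)) := [
    [[1, -1, 0], [0, -1], [0], []],
    [[1, 1, 0], [0, -1], [0], []],
    [[1, 1, 0], [0, 1], [0], []],
    [[1, 1, -1], [1, 0], [0], []],
    [[1, 1, 1], [1, 0], [0], []]]

/-- The exceptional ones on 5 vertices that contain no positive `K₄`. -/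
def exceptionalRowsFive : List (List (List ℤ)) := [
    [[1, 0, 0, 1], [1, 0, 0], [1, 0], [1], []],
    [[1, 0, 0, -1], [1, 0, 0], [1, 0], [-1], []],
    [[1, 0, 0, -1], [1, 0, 0], [-1, 0], [1], []],
    [[1, 0, 0, 1], [1, 0, 1], [1, 1], [1], []],
    [[1, 0, 0, 1], [1, 1, 1], [1, 0], [0], []],
    [[1, 0, 0, -1], [1, 1, 0], [1, 1], [1], []]]

/-- The cliques with pendant edges on 5 vertices that contain no positive `K₄`. -/
def pendantRowsFive : List (List (List ℤ)) := [
    [[1, 1, -1, 0], [1, 0, -1], [0, 0], [0], []],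
    [[1, 1, 1, 0], [1, 0, -1], [0, 0], [0], []],
    [[1, 1, 1, 0], [1, 0, 1], [0, 0], [0], []]]

/-- The exceptional ones on 6 vertices that contain no positive `K₄`. -/
def exceptionalRowsSix : List (List (List ℤ)) := [
    [[1, 0, 0, 1, 1], [1, 0, 0, 1], [1, 0, 1], [1, 1], [1], []],
    [[1, 1, 1, 0, 1], [1, 1, 1, 0], [0, 1, 1], [0, 0], [0], []]]

/-- The cliques with pendant edges on 6 vertices that contain no positive `K₄`. -/
def pendantRowsSix : List (List (List ℤ)) := [
    [[1, 1, -1, 0, 0], [1, 0, -1, 0], [0, 0, -1], [0, 0], [0], []],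
    [[1, 1, 1, 0, 0], [1, 0, -1, 0], [0, 0, -1], [0, 0], [0], []],
    [[1, 1, 1, 0, 0], [1, 0, 1, 0], [0, 0, -1], [0, 0], [0], []],
    [[1, 1, 1, 0, 0], [1, 0, 1, 0], [0, 0, 1], [0, 0], [0], []]]

/-- The cycle with exactly one positive edge on four vertices. -/
def cycleRowsFour : List (List ℤ) := [[-1, 0, 1], [-1, 0], [-1], []]

/-- The cycle with exactly one positive edge on five vertices. -/
def cycleRowsFive : List (List ℤ) := [[-1, 0, 0, 1], [-1, 0, 0], [-1, 0], [-1], []]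

lemma growthCheck_one : growthCheck rowsOne rowsTwo = true := by decide +kernel

lemma growthCheck_two :
    growthCheck rowsTwo (exceptionalRowsThree ++ pendantRowsThree) = true := by
  decide +kernel

/-- Targets other than `rowsK4` have as many vertices as the extension, so a copy of one of them is
a reordering of it. The cycle with one positive edge passes both tests and has to be carried along;
it is ruled out later by the partition into classes. -/
lemma growthCheck_three : growthCheck (exceptionalRowsThree ++ pendantRowsThree)
    (rowsK4 :: cycleRowsFour :: (exceptionalRowsFour ++ pendantRowsFour)) = true := by
  decide +kernel

lemma growthCheck_four :
    growthCheck (cycleRowsFour :: (exceptionalRowsFour ++ pendantRowsFour))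
      (rowsK4 :: cycleRowsFive :: (exceptionalRowsFive ++ pendantRowsFive)) = true := by
  decide +kernel

/-- No cycle table is needed on six vertices: a hexagon with exactly one positive edge has least
eigenvalue -√3 < -13/8. -/
lemma growthCheck_five :
    growthCheck (cycleRowsFive :: (exceptionalRowsFive ++ pendantRowsFive))
      (rowsK4 :: (exceptionalRowsSix ++ pendantRowsSix)) = true := by
  decide +kernel

lemma growthCheck_six :
    growthCheck (exceptionalRowsSix ++ pendantRowsSix) [rowsK4] = true := by
  decide +kernel

/-- The empty target says that S63 has no acceptable connected extension. -/
lemma growthCheck_S63 : growthCheck [rowsS63] [] = true := by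
  decide +kernel

/-! ### Sign systems and cliques with pendant edges -/

/-- An integral sign function on a connected set of vertices, without `-, -, +` triangles, for which
`13 I + 8 σ` is positive semidefinite. -/
structure IsSignSystem {α : Type*} (σ : α → α → ℤ) : Prop where
  symm : ∀ x y, σ x y = σ y x
  sign : ∀ x y, σ x y = 0 ∨ σ x y = 1 ∨ σ x y = -1
  triple : ∀ x y z, badTriple (σ x y) (σ x z) (σ y z) = false
  form_nonneg : ∀ vs : List α, vs.Nodup → ∀ xs : List ℤ, xs.length = vs.length →
    0 ≤ triForm (shiftedRows (upperRows σ vs)) xs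
  connected : ∀ X : Set α, X.Nonempty → X ≠ Set.univ → ∃ x ∈ X, ∃ y ∉ X, σ y x ≠ 0

/-- `π` retracts the vertices onto a positive clique, and every vertex is related only to the
vertices of the clique, if it lies there, and to at most one further vertex with the same image. -/
def IsPendantProjection {α : Type*} (σ : α → α → ℤ) (π : α → α) : Prop :=
  (∀ x, π (π x) = π x) ∧ (∀ x y, π x = x → π y = y → x ≠ y → σ x y = 1) ∧
  (∀ x y, ¬ (π x = x ∧ π y = y) → π x ≠ π y → σ x y = 0) ∧
  (∀ x y, π x ≠ x → π y ≠ y → π x = π y → x = y) ∧ ∃ x y, x ≠ y ∧ π x = x ∧ π y = y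

/-- `σ` is a positive clique on at least two vertices with at most one pendant vertex for each vertex
of the clique. -/
def IsPendantClique {α : Type*} (σ : α → α → ℤ) : Prop := ∃ π, IsPendantProjection σ π

instance {n : ℕ} (σ : Fin n → Fin n → ℤ) (π : Fin n → Fin n) :
    Decidable (IsPendantProjection σ π) := by
  unfold IsPendantProjection; infer_instance

/-- Signs are compared off the diagonal only, because `rowsEntry` is 0 on the diagonal while
`signEntry` is minus the number of fat neighbours there. -/
lemma IsPendantProjection.transfer {α β : Type*} {σ : α → α → ℤ} {τ : β → β → ℤ} {π : β → β}
    (h : IsPendantProjection τ π) (φ : β ≃ α)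
    (hφ : ∀ x y, x ≠ y → τ x y = σ (φ x) (φ y)) : IsPendantClique σ := by
  obtain ⟨h1, h2, h3, h4, x, y, hxy, hx, hy⟩ := h
  refine ⟨fun a => φ (π (φ.symm a)), ?_, ?_, ?_, ?_, φ x, φ y, ?_, ?_, ?_⟩
  · intro a; simp [h1]
  · intro a b ha hb hab
    have := hφ (φ.symm a) (φ.symm b) (by simpa using hab)
    rw [h2 _ _ (by rw [φ.eq_symm_apply]; exact ha)
      (by rw [φ.eq_symm_apply]; exact hb) (by simpa using hab)] at this
    simpa using this.symm
  · intro a b hab hne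
    have hne' : π (φ.symm a) ≠ π (φ.symm b) := fun h => hne (by simp [h])
    have := hφ (φ.symm a) (φ.symm b) (fun h => hne' (by rw [h]))
    rw [h3 _ _ (by rw [φ.eq_symm_apply, φ.eq_symm_apply]; exact hab)
      hne'] at this
    simpa using this.symm
  · intro a b ha hb hab
    refine φ.symm.injective (h4 _ _ ?_ ?_ (φ.injective hab))
    · rwa [Ne, φ.eq_symm_apply]
    · rwa [Ne, φ.eq_symm_apply]
  · simpa using hxy
  · simp [hx]
  · simp [hy]

lemma isPendantClique_of_upperRows {α : Type*} {σ : α → α → ℤ} (hσ : ∀ x y, σ x y = σ y x)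
    {vs : List α} (hvs : vs.Nodup) (hall : ∀ x, x ∈ vs) {n : ℕ} (g : List (List ℤ))
    (hn : g.length = n) (hg : upperRows σ vs = g) (π : Fin n → Fin n)
    (hπ : IsPendantProjection (fun i j : Fin n => rowsEntry g i j) π) : IsPendantClique σ := by
  classical
  subst hg
  rw [length_upperRows] at hn
  subst hn
  refine hπ.transfer (hvs.getEquivOfForallMemList vs hall) fun x y hxy => ?_
  rw [rowsEntry_upperRows σ hσ vs x y x.2 y.2 (by simpa [Fin.ext_iff] using hxy)]
  rfl

/-- In the tables the clique comes first, and the pendant vertices follow in the order of their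
neighbours. -/
def tablePi (n r : ℕ) [NeZero n] (i : Fin n) : Fin n :=
  if (i : ℕ) < r then i else Fin.ofNat n (i - r)

lemma isPendantClique_of_mem {α : Type*} {σ : α → α → ℤ} (hσ : ∀ x y, σ x y = σ y x)
    {vs : List α} (hvs : vs.Nodup) (hall : ∀ x, x ∈ vs)
    (h : upperRows σ vs ∈ pendantRowsThree ++ pendantRowsFour ++ pendantRowsFive ++
      pendantRowsSix) : IsPendantClique σ := by
  simp only [pendantRowsThree, pendantRowsFour, pendantRowsFive, pendantRowsSix, List.mem_append,
    List.mem_cons, List.not_mem_nil, or_false, or_assoc] at h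
  rcases h with h | h | h | h | h | h | h | h | h | h | h | h | h | h | h
  all_goals first
    | exact isPendantClique_of_upperRows hσ hvs hall (n := 3) _ rfl h (tablePi 3 2) (by decide)
    | exact isPendantClique_of_upperRows hσ hvs hall (n := 3) _ rfl h (tablePi 3 3) (by decide)
    | exact isPendantClique_of_upperRows hσ hvs hall (n := 4) _ rfl h (tablePi 4 2) (by decide)
    | exact isPendantClique_of_upperRows hσ hvs hall (n := 4) _ rfl h (tablePi 4 3) (by decide)
    | exact isPendantClique_of_upperRows hσ hvs hall (n := 5) _ rfl h (tablePi 5 3)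
        (by decide +kernel)
    | exact isPendantClique_of_upperRows hσ hvs hall (n := 6) _ rfl h (tablePi 6 3)
        (by decide +kernel)

namespace IsSignSystem

variable {α : Type*} {σ : α → α → ℤ}

lemma accept (h : IsSignSystem σ) (vs : List α) (hvs : vs.Nodup) :
    acceptRows (upperRows σ vs) = true := by
  rw [acceptRows, tripleTest_upperRows σ h.triple, Bool.true_and]
  refine pivotTest_of_nonneg _ _ (isTriangle_shiftedRows σ vs) fun xs hxs => ?_
  exact h.form_nonneg vs hvs xs (by simpa [shiftedRows, length_upperRows] using hxs)

lemma mem_signs (h : IsSignSystem σ) (x y : α) : σ x y ∈ ([0, 1, -1] : List ℤ) := by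
  simpa using h.sign x y

/-- Distinct indices keep the lookup off the diagonal, and indices in range keep it off the default
`d`. -/
lemma upperRows_map_get (h : IsSignSystem σ) (vs : List α) (p : List ℕ) (hp : p.Nodup)
    (hlt : ∀ i ∈ p, i < vs.length) (d : α) :
    upperRows σ (p.map fun i => vs.getD i d) = upperRows (rowsEntry (upperRows σ vs)) p := by
  induction p with
  | nil => rfl
  | cons i p ih =>
    rw [List.nodup_cons] at hp
    have hi := hlt i List.mem_cons_self
    simp only [List.map_cons, upperRows]
    rw [ih hp.2 fun j hj => hlt j (List.mem_cons_of_mem _ hj), List.map_map]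
    congr 1
    refine List.map_congr_left fun j hj => ?_
    have hjl := hlt j (List.mem_cons_of_mem _ hj)
    rw [rowsEntry_upperRows σ h.symm vs i j hi hjl (by rintro rfl; exact hp.1 hj)]
    simp [hi, hjl]

/-- Connectedness supplies an outside vertex with a nonzero row over `vs`. That row is among the
finitely many tested and is acceptable, so the check returns indices of a copy. -/
lemma grow (h : IsSignSystem σ) {src tgt : List (List (List ℤ))} (hc : growthCheck src tgt = true)
    {vs : List α} (hvs : vs.Nodup) (hne : vs ≠ []) (hmem : upperRows σ vs ∈ src) :
    (∀ x, x ∈ vs) ∨ ∃ ws : List α, ws.Nodup ∧ upperRows σ ws ∈ tgt := by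
  by_cases hall : ∀ x, x ∈ vs
  · exact Or.inl hall
  right
  push Not at hall
  obtain ⟨z, hz⟩ := hall
  obtain ⟨x, hx, y, hy, hxy⟩ := h.connected {x | x ∈ vs}
    (by obtain ⟨a, l, rfl⟩ := List.exists_cons_of_ne_nil hne; exact ⟨a, by simp⟩)
    (fun he => hz ((Set.ext_iff.1 he z).2 trivial))
  have hnd : (y :: vs).Nodup := List.nodup_cons.2 ⟨hy, hvs⟩
  rw [growthCheck, List.all_eq_true] at hc
  have hc := List.all_eq_true.1 (hc _ hmem) (vs.map (σ y)) (by
    have := mem_signLists (vs.map (σ y)) (by simpa using fun a _ => h.sign y a)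
    rwa [List.length_map, ← length_upperRows σ] at this)
  have h0 : (vs.map (σ y)).all (· == 0) = false := by
    simp only [List.all_eq_false, List.mem_map, beq_iff_eq]
    exact ⟨_, ⟨x, hx, rfl⟩, hxy⟩
  have ha : acceptRows (vs.map (σ y) :: upperRows σ vs) = true := h.accept _ hnd
  rw [h0, ha] at hc
  simp only [Bool.not_true, Bool.false_or, List.any_eq_true] at hc
  obtain ⟨g', hg', hp⟩ := hc
  obtain ⟨p, hp⟩ : ∃ p, p ∈ copies ((upperRows σ vs).length + 1)
      (rowsEntry (vs.map (σ y) :: upperRows σ vs)) g' := by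
    refine List.exists_mem_of_ne_nil _ fun he => ?_
    simp [he] at hp
  obtain ⟨h1, h2, h3⟩ := mem_copies hp
  rw [length_upperRows] at h2
  refine ⟨p.map fun i => (y :: vs).getD i y, ?_, ?_⟩
  · refine (List.nodup_map_iff_inj_on h1).2 fun i hi j hj hij => ?_
    have hi' : i < (y :: vs).length := h2 i hi
    have hj' : j < (y :: vs).length := h2 j hj
    rw [List.getD_eq_getElem _ _ hi', List.getD_eq_getElem _ _ hj'] at hij
    exact (hnd.getElem_inj_iff).1 hij
  · rw [h.upperRows_map_get (y :: vs) p h1 h2 y]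
    exact (show upperRows (rowsEntry (vs.map (σ y) :: upperRows σ vs)) p = g' from h3) ▸ hg'

end IsSignSystem

/-! ### Vertices around a positive K₄ -/

/-- The clique is symmetric, so here and in the next three lemmas the attaching vertices may be
listed first. Together they say: attachment at two vertices forces attachment to all four, two
vertices attached at one place form a positive triangle with it, vertices attached at different
places are unrelated, and nothing lies at distance two. -/
lemma accept_nbr_K4 : ∀ x ∈ ([0, 1, -1] : List ℤ), ∀ y ∈ ([0, 1, -1] : List ℤ),
    ∀ z ∈ ([0, 1, -1] : List ℤ), ∀ w ∈ ([0, 1, -1] : List ℤ),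
    acceptRows ([x, y, z, w] :: rowsK4) = true →
      x = 0 ∨ y = 0 ∨ (x = 1 ∧ y = 1 ∧ z = 1 ∧ w = 1) := by
  decide +kernel

lemma accept_two_at_same_K4 : ∀ x ∈ ([0, 1, -1] : List ℤ), ∀ y ∈ ([0, 1, -1] : List ℤ),
    ∀ z ∈ ([0, 1, -1] : List ℤ), acceptRows ([x, y, 0, 0, 0] :: [z, 0, 0, 0] :: rowsK4) = true →
      y = 0 ∨ z = 0 ∨ (x = 1 ∧ y = 1 ∧ z = 1) := by
  decide +kernel

lemma accept_two_at_K4 : ∀ x ∈ ([0, 1, -1] : List ℤ), ∀ y ∈ ([0, 1, -1] : List ℤ),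
    ∀ z ∈ ([0, 1, -1] : List ℤ), acceptRows ([x, y, 0, 0, 0] :: [0, z, 0, 0] :: rowsK4) = true →
      x = 0 ∨ y = 0 ∨ z = 0 := by
  decide +kernel

lemma accept_path_K4 : ∀ x ∈ ([0, 1, -1] : List ℤ), ∀ z ∈ ([0, 1, -1] : List ℤ),
    acceptRows ([x, 0, 0, 0, 0] :: [z, 0, 0, 0] :: rowsK4) = true → x = 0 ∨ z = 0 := by
  decide +kernel

namespace IsSignSystem

variable {α : Type*} {σ : α → α → ℤ}

lemma exists_mem_notMem {K : Finset α} (l : List α) (h : l.length < K.card) :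
    ∃ x ∈ K, x ∉ l := by
  classical
  obtain ⟨x, hx, hl⟩ := Finset.exists_mem_notMem_of_card_lt_card
    ((List.toFinset_card_le l).trans_lt h)
  exact ⟨x, hx, by simpa using hl⟩

/-- A positive clique with at least four vertices that is not contained in a larger one. -/
structure IsMaxClique (σ : α → α → ℤ) (K : Finset α) : Prop where
  four_le : 4 ≤ K.card
  pos : ∀ x ∈ K, ∀ y ∈ K, x ≠ y → σ x y = 1
  maximal : ∀ u ∉ K, ∃ k ∈ K, σ u k ≠ 1

lemma exists_isMaxClique [Finite α] (h : IsSignSystem σ) {vs : List α} (hvs : vs.Nodup)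
    (hK : upperRows σ vs = rowsK4) : ∃ K, IsMaxClique σ K := by
  classical
  obtain ⟨K₀, hK₀, hc₀⟩ : ∃ K : Finset α, (∀ x ∈ K, ∀ y ∈ K, x ≠ y → σ x y = 1) ∧ 4 ≤ K.card := by
    have hl := congrArg List.length hK
    rw [length_upperRows] at hl
    obtain ⟨a, b, c, d, rfl⟩ := List.length_eq_four.1 hl
    refine ⟨{a, b, c, d}, ?_, ?_⟩
    · simp only [upperRows, rowsK4, List.map_cons, List.map_nil, List.cons.injEq, and_true] at hK
      obtain ⟨⟨h1, h2, h3⟩, ⟨h4, h5⟩, h6⟩ := hK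
      intro x hx y hy hxy
      simp only [Finset.mem_insert, Finset.mem_singleton] at hx hy
      rcases hx with rfl | rfl | rfl | rfl <;> rcases hy with rfl | rfl | rfl | rfl <;>
        first | exact absurd rfl hxy | assumption | (rw [h.symm]; assumption)
    · have := List.toFinset_card_of_nodup hvs
      simp at this
      rw [this]
  have : Fintype α := Fintype.ofFinite α
  obtain ⟨K, hK, hmax⟩ := Finset.exists_max_image
    (Finset.univ.filter fun K : Finset α => ∀ x ∈ K, ∀ y ∈ K, x ≠ y → σ x y = 1) Finset.card
    ⟨K₀, by simpa using hK₀⟩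
  simp only [Finset.mem_filter, Finset.mem_univ, true_and] at hK hmax
  refine ⟨K, hc₀.trans (hmax _ hK₀), hK, fun u hu => ?_⟩
  by_contra! hall
  have := hmax (insert u K) fun x hx y hy hxy => by
    rw [Finset.mem_insert] at hx hy
    rcases hx with rfl | hx <;> rcases hy with rfl | hy
    · exact absurd rfl hxy
    · exact hall y hy
    · rw [h.symm]; exact hall x hx
    · exact hK x hx y hy hxy
  rw [Finset.card_insert_of_notMem hu] at this
  omega

lemma IsMaxClique.upperRows_four {K : Finset α} (hK : IsMaxClique σ K) {a b c d : α}
    (ha : a ∈ K) (hb : b ∈ K) (hc : c ∈ K) (hd : d ∈ K) (hnd : [a, b, c, d].Nodup) :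
    upperRows σ [a, b, c, d] = rowsK4 := by
  simp only [List.nodup_cons, List.mem_cons, List.not_mem_nil, or_false, not_or,
    List.nodup_nil, not_false_eq_true, and_true] at hnd
  obtain ⟨⟨h1, h2, h3⟩, ⟨h4, h5⟩, h6⟩ := hnd
  simp [upperRows, rowsK4, hK.pos a ha b hb h1, hK.pos a ha c hc h2, hK.pos a ha d hd h3,
    hK.pos b hb c hc h4, hK.pos b hb d hd h5, hK.pos c hc d hd h6]

lemma IsMaxClique.nbr_unique (h : IsSignSystem σ) {K : Finset α} (hK : IsMaxClique σ K) {u : α}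
    (hu : u ∉ K) {k l : α} (hk : k ∈ K) (hl : l ∈ K) (huk : σ u k ≠ 0) (hul : σ u l ≠ 0) :
    k = l := by
  by_contra hkl
  obtain ⟨m, hm, hum⟩ := hK.maximal u hu
  -- The four chosen clique vertices must include m, so that the all-ones outcome contradicts
  -- maximality.
  have key : ∀ a b, a ∈ K → b ∈ K → [k, l, a, b].Nodup → m ∈ [k, l, a, b] → False := by
    intro a b ha hb hnd hmem
    have hacc := h.accept (u :: [k, l, a, b]) (List.nodup_cons.2 ⟨by
      simp only [List.mem_cons, List.not_mem_nil, or_false, not_or]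
      exact ⟨fun e => hu (e ▸ hk), fun e => hu (e ▸ hl), fun e => hu (e ▸ ha),
        fun e => hu (e ▸ hb)⟩, hnd⟩)
    rw [upperRows, hK.upperRows_four hk hl ha hb hnd] at hacc
    rcases accept_nbr_K4 _ (h.mem_signs u k) _ (h.mem_signs u l) _ (h.mem_signs u a) _
      (h.mem_signs u b) hacc with h0 | h0 | ⟨h1, h2, h3, h4⟩
    · exact huk h0
    · exact hul h0
    · simp only [List.mem_cons, List.not_mem_nil, or_false] at hmem
      rcases hmem with rfl | rfl | rfl | rfl <;> contradiction
  have h4 := hK.four_le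
  by_cases hm' : m ∈ [k, l]
  · obtain ⟨a, ha, hal⟩ := exists_mem_notMem (K := K) [k, l] (by simp; omega)
    obtain ⟨b, hb, hbl⟩ := exists_mem_notMem (K := K) [k, l, a] (by simp; omega)
    refine key a b ha hb ?_ (by simp at hm' ⊢; tauto)
    simp at hal hbl ⊢
    tauto
  · obtain ⟨b, hb, hbl⟩ := exists_mem_notMem (K := K) [k, l, m] (by simp; omega)
    refine key m b hm hb ?_ (by simp)
    simp at hm' hbl ⊢
    tauto

lemma IsMaxClique.eq_zero (h : IsSignSystem σ) {K : Finset α} (hK : IsMaxClique σ K) {u : α}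
    (hu : u ∉ K) {k l : α} (hk : k ∈ K) (hl : l ∈ K) (huk : σ u k ≠ 0) (hkl : k ≠ l) :
    σ u l = 0 := by
  by_contra hul
  exact hkl (hK.nbr_unique h hu hk hl huk hul)

lemma IsMaxClique.exists_three {K : Finset α} (hK : IsMaxClique σ K) (k : α) :
    ∃ a ∈ K, ∃ b ∈ K, ∃ c ∈ K, [k, a, b, c].Nodup := by
  have h4 := hK.four_le
  obtain ⟨a, ha, hal⟩ := exists_mem_notMem (K := K) [k] (by simp; omega)
  obtain ⟨b, hb, hbl⟩ := exists_mem_notMem (K := K) [k, a] (by simp; omega)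
  obtain ⟨c, hc, hcl⟩ := exists_mem_notMem (K := K) [k, a, b] (by simp; omega)
  refine ⟨a, ha, b, hb, c, hc, ?_⟩
  simp at hal hbl hcl ⊢
  tauto

lemma nodup_cons_cons {K : Finset α} {u w a b c d : α} (hu : u ∉ K) (hw : w ∉ K) (huw : u ≠ w)
    (ha : a ∈ K) (hb : b ∈ K) (hc : c ∈ K) (hd : d ∈ K) (hnd : [a, b, c, d].Nodup) :
    (u :: w :: [a, b, c, d]).Nodup := by
  have aux : ∀ v ∉ K, v ∉ [a, b, c, d] := by
    intro v hv hmem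
    simp only [List.mem_cons, List.not_mem_nil, or_false] at hmem
    rcases hmem with rfl | rfl | rfl | rfl <;> contradiction
  refine List.nodup_cons.2 ⟨?_, List.nodup_cons.2 ⟨aux w hw, hnd⟩⟩
  rw [List.mem_cons, not_or]
  exact ⟨huw, aux u hu⟩

lemma IsMaxClique.copy_S63 (h : IsSignSystem σ) {K : Finset α} (hK : IsMaxClique σ K) {u w : α}
    (hu : u ∉ K) (hw : w ∉ K) (huw : u ≠ w) {k : α} (hk : k ∈ K) (huk : σ u k ≠ 0)
    (hwk : σ w k ≠ 0) : ∃ vs : List α, vs.Nodup ∧ upperRows σ vs = rowsS63 := by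
  obtain ⟨a, ha, b, hb, c, hc, hnd⟩ := hK.exists_three k
  have hnd' := nodup_cons_cons hu hw huw hk ha hb hc hnd
  have hacc := h.accept _ hnd'
  have hK4 := hK.upperRows_four hk ha hb hc hnd
  have hne : k ≠ a ∧ k ≠ b ∧ k ≠ c := by simp at hnd; tauto
  have hua := hK.eq_zero h hu hk ha huk hne.1
  have hub := hK.eq_zero h hu hk hb huk hne.2.1
  have huc := hK.eq_zero h hu hk hc huk hne.2.2
  have hwa := hK.eq_zero h hw hk ha hwk hne.1
  have hwb := hK.eq_zero h hw hk hb hwk hne.2.1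
  have hwc := hK.eq_zero h hw hk hc hwk hne.2.2
  rw [upperRows, upperRows, hK4] at hacc
  simp only [List.map_cons, List.map_nil, hua, hub, huc, hwa, hwb, hwc] at hacc
  rcases accept_two_at_same_K4 _ (h.mem_signs u w) _ (h.mem_signs u k) _ (h.mem_signs w k) hacc
    with h0 | h0 | ⟨h1, h2, h3⟩
  · exact absurd h0 huk
  · exact absurd h0 hwk
  -- The order of `rowsS63`: the two vertices of the triangle outside the K₄ come first and last.
  refine ⟨[u, k, a, b, c, w], ?_, ?_⟩
  · refine (List.Perm.nodup_iff ?_).1 hnd'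
    exact List.Perm.cons u (List.perm_append_singleton w [k, a, b, c]).symm
  · simp only [upperRows, rowsK4, List.map_cons, List.map_nil, List.cons.injEq, and_true] at hK4
    obtain ⟨⟨e1, e2, e3⟩, ⟨e4, e5⟩, e6⟩ := hK4
    simp [upperRows, rowsS63, h1, h2, h3, hua, hub, huc, e1, e2, e3, e4, e5, e6, h.symm _ w, hwa,
      hwb, hwc]

lemma IsMaxClique.eq_zero_of_ne (h : IsSignSystem σ) {K : Finset α} (hK : IsMaxClique σ K)
    {u w : α} (hu : u ∉ K) (hw : w ∉ K) (huw : u ≠ w) {k l : α} (hk : k ∈ K) (hl : l ∈ K)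
    (hkl : k ≠ l) (huk : σ u k ≠ 0) (hwl : σ w l ≠ 0) : σ u w = 0 := by
  have h4 := hK.four_le
  obtain ⟨a, ha, hal⟩ := exists_mem_notMem (K := K) [k, l] (by simp; omega)
  obtain ⟨b, hb, hbl⟩ := exists_mem_notMem (K := K) [k, l, a] (by simp; omega)
  have hnd : [k, l, a, b].Nodup := by simp at hal hbl ⊢; tauto
  have hacc := h.accept _ (nodup_cons_cons hu hw huw hk hl ha hb hnd)
  simp only [List.mem_cons, List.not_mem_nil, or_false, not_or] at hal hbl
  rw [upperRows, upperRows, hK.upperRows_four hk hl ha hb hnd] at hacc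
  simp only [List.map_cons, List.map_nil, hK.eq_zero h hu hk hl huk hkl,
    hK.eq_zero h hu hk ha huk (Ne.symm hal.1), hK.eq_zero h hu hk hb huk (Ne.symm hbl.1),
    hK.eq_zero h hw hl hk hwl hkl.symm, hK.eq_zero h hw hl ha hwl (Ne.symm hal.2),
    hK.eq_zero h hw hl hb hwl (Ne.symm hbl.2.1)] at hacc
  rcases accept_two_at_K4 _ (h.mem_signs u w) _ (h.mem_signs u k) _ (h.mem_signs w l) hacc
    with h0 | h0 | h0
  · exact h0
  · exact absurd h0 huk
  · exact absurd h0 hwl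

lemma IsMaxClique.exists_nbr (h : IsSignSystem σ) {K : Finset α} (hK : IsMaxClique σ K) {u : α}
    (hu : u ∉ K) : ∃ k ∈ K, σ u k ≠ 0 := by
  by_contra hno
  have h4 := hK.four_le
  obtain ⟨k₀, hk₀⟩ : K.Nonempty := Finset.card_pos.1 (by omega)
  -- An edge leaving the closed neighbourhood of K would end at a vertex at distance two from K.
  obtain ⟨x, hx, y, hy, hxy⟩ := h.connected {x | x ∈ K ∨ ∃ k ∈ K, σ x k ≠ 0} ⟨k₀, Or.inl hk₀⟩
    (fun he => by
      have : u ∈ {x | x ∈ K ∨ ∃ k ∈ K, σ x k ≠ 0} := he ▸ Set.mem_univ u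
      exact this.elim hu hno)
  simp only [Set.mem_ofPred_eq, not_or, not_exists, not_and, not_not] at hx hy
  obtain ⟨hyK, hy0⟩ := hy
  by_cases hxK : x ∈ K
  · exact hxy (hy0 x hxK)
  obtain ⟨k, hk, hxk⟩ := hx.resolve_left hxK
  obtain ⟨a, ha, b, hb, c, hc, hnd⟩ := hK.exists_three k
  have hne : k ≠ a ∧ k ≠ b ∧ k ≠ c := by simp at hnd; tauto
  have hacc := h.accept _ (nodup_cons_cons hyK hxK (by rintro rfl; exact hxk (hy0 k hk)) hk ha hb
    hc hnd)
  rw [upperRows, upperRows, hK.upperRows_four hk ha hb hc hnd] at hacc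
  simp only [List.map_cons, List.map_nil, hy0 k hk, hy0 a ha, hy0 b hb, hy0 c hc,
    hK.eq_zero h hxK hk ha hxk hne.1, hK.eq_zero h hxK hk hb hxk hne.2.1,
    hK.eq_zero h hxK hk hc hxk hne.2.2] at hacc
  rcases accept_path_K4 _ (h.mem_signs y x) _ (h.mem_signs x k) hacc with h0 | h0
  · exact hxy h0
  · exact hxk h0

lemma IsMaxClique.isPendantClique_or (h : IsSignSystem σ) {K : Finset α} (hK : IsMaxClique σ K) :
    IsPendantClique σ ∨ ∃ vs : List α, vs.Nodup ∧ upperRows σ vs = rowsS63 := by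
  classical
  refine or_iff_not_imp_right.2 fun hno => ?_
  choose! f hfK hf using fun u (hu : u ∉ K) => hK.exists_nbr h hu
  -- Clique vertices stay fixed; any other vertex goes to its only neighbour in the clique.
  set π : α → α := fun u => if u ∈ K then u else f u with hπ
  have hin : ∀ u ∈ K, π u = u := fun u hu => if_pos hu
  have hout : ∀ u ∉ K, π u = f u := fun u hu => if_neg hu
  have hmem : ∀ u, π u ∈ K := fun u => by
    by_cases hu : u ∈ K
    · rwa [hin u hu]
    · rw [hout u hu]; exact hfK u hu
  have hfix : ∀ u, π u = u ↔ u ∈ K := fun u => ⟨fun e => e ▸ hmem u, hin u⟩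
  have hzero : ∀ u ∉ K, ∀ k ∈ K, f u ≠ k → σ u k = 0 := fun u hu k hk hne =>
    hK.eq_zero h hu (hfK u hu) hk (hf u hu) hne
  refine ⟨π, fun x => hin _ (hmem x), ?_, ?_, ?_, ?_⟩
  · intro x y hx hy hxy
    exact hK.pos x ((hfix x).1 hx) y ((hfix y).1 hy) hxy
  · intro x y hxy hne
    rw [hfix, hfix] at hxy
    by_cases hx : x ∈ K
    · have hy : y ∉ K := fun hy => hxy ⟨hx, hy⟩
      rw [hin x hx, hout y hy] at hne
      rw [h.symm]
      exact hzero y hy x hx hne.symm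
    · by_cases hy : y ∈ K
      · rw [hin y hy, hout x hx] at hne
        exact hzero x hx y hy hne
      · rw [hout x hx, hout y hy] at hne
        exact hK.eq_zero_of_ne h hx hy (fun e => hne (by rw [e])) (hfK x hx) (hfK y hy) hne
          (hf x hx) (hf y hy)
  · intro x y hx hy hxy
    rw [Ne, hfix] at hx hy
    rw [hout x hx, hout y hy] at hxy
    by_contra hne
    exact hno (hK.copy_S63 h hx hy hne (hfK x hx) (hf x hx) (hxy ▸ hf y hy))
  · have h4 := hK.four_le
    obtain ⟨a, ha, b, hb, hab⟩ := Finset.one_lt_card.1 (show 1 < K.card by omega)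
    exact ⟨a, b, hab, hin a ha, hin b hb⟩

/-- A sign system that is not a clique with pendant edges is one of those in the tables. -/
theorem classification [Finite α] [Nonempty α] (h : IsSignSystem σ) (hno : ¬ IsPendantClique σ) :
    ∃ vs : List α, vs.Nodup ∧ (∀ x, x ∈ vs) ∧ upperRows σ vs ∈
      rowsOne ++ rowsTwo ++ [cycleRowsFour, cycleRowsFive] ++ (exceptionalRowsThree ++
        exceptionalRowsFour ++ exceptionalRowsFive ++ exceptionalRowsSix ++ [rowsS63]) := by
  by_cases hK4 : ∃ vs : List α, vs.Nodup ∧ upperRows σ vs = rowsK4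
  · obtain ⟨vs, hvs, hK⟩ := hK4
    obtain ⟨K, hK⟩ := h.exists_isMaxClique hvs hK
    obtain ⟨ws, hws, hS⟩ := (hK.isPendantClique_or h).resolve_left hno
    rcases h.grow growthCheck_S63 hws (by rintro rfl; simp [upperRows, rowsS63] at hS)
      (by simp [hS]) with hall | ⟨_, _, hmem⟩
    · exact ⟨ws, hws, hall, by simp [hS]⟩
    · simp at hmem
  have hK4' : ∀ vs : List α, vs.Nodup → upperRows σ vs ≠ rowsK4 := fun vs h1 h2 => hK4 ⟨vs, h1, h2⟩
  have hpend : ∀ vs : List α, vs.Nodup → (∀ x, x ∈ vs) → upperRows σ vs ∉ pendantRowsThree ++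
      pendantRowsFour ++ pendantRowsFive ++ pendantRowsSix :=
    fun vs h1 h2 h3 => hno (isPendantClique_of_mem h.symm h1 h2 h3)
  by_contra hcon
  have step : ∀ src tgt : List (List (List ℤ)), growthCheck src tgt = true → [] ∉ src →
      (∀ vs : List α, vs.Nodup → (∀ x, x ∈ vs) → upperRows σ vs ∉ src) →
      (∃ vs : List α, vs.Nodup ∧ upperRows σ vs ∈ src) →
      ∃ vs : List α, vs.Nodup ∧ upperRows σ vs ∈ tgt := by
    rintro src tgt hc hnil hsrc ⟨vs, hvs, hmem⟩
    rcases h.grow hc hvs (by rintro rfl; exact hnil hmem) hmem with hall | hex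
    · exact absurd hmem (hsrc vs hvs hall)
    · exact hex
  have drop : ∀ tgt : List (List (List ℤ)),
      (∃ vs : List α, vs.Nodup ∧ upperRows σ vs ∈ rowsK4 :: tgt) →
      ∃ vs : List α, vs.Nodup ∧ upperRows σ vs ∈ tgt := by
    rintro tgt ⟨vs, hvs, hmem⟩
    exact ⟨vs, hvs, (List.mem_cons.1 hmem).resolve_left (hK4' vs hvs)⟩
  have hsub : ∀ src : List (List (List ℤ)), (∀ g ∈ src, g ∈ (rowsOne ++ rowsTwo ++
        [cycleRowsFour, cycleRowsFive] ++ (exceptionalRowsThree ++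
        exceptionalRowsFour ++ exceptionalRowsFive ++ exceptionalRowsSix ++ [rowsS63])) ++
        (pendantRowsThree ++ pendantRowsFour ++ pendantRowsFive ++ pendantRowsSix)) →
      ∀ vs : List α, vs.Nodup → (∀ x, x ∈ vs) → upperRows σ vs ∉ src := by
    intro src hsrc vs hvs hall hmem
    rcases List.mem_append.1 (hsrc _ hmem) with h1 | h1
    · exact hcon ⟨vs, hvs, hall, h1⟩
    · exact hpend vs hvs hall h1
  obtain ⟨v⟩ := ‹Nonempty α›
  have s1 : ∃ vs : List α, vs.Nodup ∧ upperRows σ vs ∈ rowsOne :=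
    ⟨[v], by simp, by simp [upperRows, rowsOne]⟩
  -- By `hcon` and `hpend` no listed configuration covers all vertices, so every stage can be
  -- extended, until the target list is empty.
  have s2 := step _ _ growthCheck_one (by decide) (hsub _ (by decide +kernel)) s1
  have s3 := step _ _ growthCheck_two (by decide) (hsub _ (by decide +kernel)) s2
  have s4 := drop _ (step _ _ growthCheck_three (by decide) (hsub _ (by decide +kernel)) s3)
  have s5 := drop _ (step _ _ growthCheck_four (by decide) (hsub _ (by decide +kernel)) s4)
  have s6 := drop _ (step _ _ growthCheck_five (by decide) (hsub _ (by decide +kernel)) s5)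
  obtain ⟨vs, -, hmem⟩ :=
    drop _ (step _ _ growthCheck_six (by decide) (hsub _ (by decide +kernel)) s6)
  simp at hmem

end IsSignSystem

/-! ### Positive semidefinite real matrices -/

namespace Matrix

/-- A real symmetric matrix with at most one nonzero off-diagonal entry in each row is positive
semidefinite if its `2 × 2` principal minors and its diagonal are nonnegative. -/
lemma posSemidef_of_unique_partner {n : Type*} [Fintype n] (M : Matrix n n ℝ)
    (hsymm : ∀ x y, M x y = M y x) (hdiag : ∀ x, 0 ≤ M x x)
    (hminor : ∀ x y, x ≠ y → M x y ^ 2 ≤ M x x * M y y)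
    (hpartner : ∀ x y z, y ≠ x → z ≠ x → M x y ≠ 0 → M x z ≠ 0 → y = z) : M.PosSemidef := by
  classical
  refine .of_dotProduct_mulVec_nonneg (by ext x y; simp [hsymm x y]) fun v => ?_
  set w : n → ℝ := fun x => M x x * v x ^ 2 with hw
  have hw0 : ∀ x, 0 ≤ w x := fun x => mul_nonneg (hdiag x) (sq_nonneg _)
  set P : n → n → Prop := fun x y => y ≠ x ∧ M x y ≠ 0 with hP
  have hPs : ∀ x y, P x y ↔ P y x := fun x y => by simp only [hP, hsymm x y, ne_comm]
  -- A vertex has at most one partner, so its diagonal term is spent at most once.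
  have hone : ∀ x, ∑ y, (if P x y then w x else 0) ≤ w x := fun x => by
    rw [← Finset.sum_filter, Finset.sum_const, nsmul_eq_mul]
    have : ((Finset.univ.filter (P x)).card : ℝ) ≤ 1 := by
      exact_mod_cast Finset.card_le_one.2 fun y hy z hz => by
        simp only [hP, Finset.mem_filter, Finset.mem_univ, true_and] at hy hz
        exact hpartner x y z hy.1 hz.1 hy.2 hz.2
    nlinarith [hw0 x]
  -- The sum runs over ordered pairs, so each of (x, y) and (y, x) is charged half of the two
  -- diagonal terms.
  have hpt : ∀ x y, (if x = y then w x else 0) -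
      ((if P x y then w x else 0) + (if P y x then w y else 0)) / 2 ≤ v x * (M x y * v y) := by
    intro x y
    by_cases hxy : x = y
    · subst hxy
      have : ¬ P x x := fun h => h.1 rfl
      simp only [this, if_true, if_false, hw]
      nlinarith
    · by_cases h0 : M x y = 0
      · have h1 : ¬ P x y := fun h => h.2 h0
        simp [hxy, h1, (hPs x y).not.1 h1, h0]
      · have h1 : P x y := ⟨Ne.symm hxy, h0⟩
        simp only [hxy, h1, (hPs x y).1 h1, if_true, if_false]
        -- By the minor condition and the inequality of means, (2 M x y · v x · v y)² ≤ 4 w x · w y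
        -- ≤ (w x + w y)².
        have := abs_le_of_sq_le_sq' (a := 2 * (v x * (M x y * v y))) (b := w x + w y) (by
          have h2 := mul_le_mul_of_nonneg_right (hminor x y hxy) (sq_nonneg (v x * v y))
          simp only [hw]
          nlinarith [sq_nonneg (M x x * v x ^ 2 - M y y * v y ^ 2)])
          (add_nonneg (hw0 x) (hw0 y))
        linarith [this.1]
  have hsum := Finset.sum_le_sum fun x (_ : x ∈ Finset.univ) =>
    Finset.sum_le_sum fun y (_ : y ∈ Finset.univ) => hpt x y
  have hlhs : 0 ≤ ∑ x, ∑ y, ((if x = y then w x else 0) -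
      ((if P x y then w x else 0) + (if P y x then w y else 0)) / 2) := by
    simp only [Finset.sum_sub_distrib, ← Finset.sum_div, Finset.sum_add_distrib]
    rw [Finset.sum_comm (f := fun x y => if P y x then w y else 0)]
    have := Finset.sum_le_sum fun x (_ : x ∈ Finset.univ) => hone x
    simp only [Finset.sum_ite_eq, Finset.mem_univ, if_true]
    linarith
  simpa [dotProduct, mulVec, Finset.mul_sum] using hlhs.trans hsum

/-- Nonemptiness matters: an empty spectrum would have infimum 0 by convention. -/
lemma posSemidef_sub_smul_one_iff {n : Type*} [Fintype n] [DecidableEq n] [Nonempty n]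
    {A : Matrix n n ℝ} (hA : A.IsHermitian) (α : ℝ) :
    α ≤ sInf {c : ℝ | Module.End.HasEigenvalue A.mulVecLin c} ↔ (A - α • 1).PosSemidef := by
  have hmem : ∀ i, hA.eigenvalues i ∈ {c : ℝ | Module.End.HasEigenvalue A.mulVecLin c} := by
    intro i
    refine Module.End.hasEigenvalue_of_hasEigenvector
      (x := (hA.eigenvectorBasis i : EuclideanSpace ℝ n).ofLp) ⟨?_, ?_⟩
    · rw [Module.End.mem_eigenspace_iff, mulVecLin_apply, hA.mulVec_eigenvectorBasis]
    · intro h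
      exact hA.eigenvectorBasis.orthonormal.ne_zero i (by ext j; exact congrFun h j)
  have hherm : (A - α • 1).IsHermitian := by
    refine hA.sub ?_
    rw [IsHermitian, conjTranspose_smul, conjTranspose_one, star_trivial]
  constructor
  · intro h
    rw [hherm.posSemidef_iff_eigenvalues_nonneg]
    intro i
    have hv := hherm.mulVec_eigenvectorBasis i
    rw [sub_mulVec, smul_mulVec, one_mulVec, sub_eq_iff_eq_add, ← add_smul] at hv
    have : Module.End.HasEigenvalue A.mulVecLin (hherm.eigenvalues i + α) := by
      refine Module.End.hasEigenvalue_of_hasEigenvector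
        (x := (hherm.eigenvectorBasis i : EuclideanSpace ℝ n).ofLp) ⟨?_, ?_⟩
      · rw [Module.End.mem_eigenspace_iff, mulVecLin_apply, hv]
      · intro h
        exact hherm.eigenvectorBasis.orthonormal.ne_zero i (by ext j; exact congrFun h j)
    have hfin : {c : ℝ | Module.End.HasEigenvalue A.mulVecLin c}.Finite :=
      Module.End.finite_hasEigenvalue _
    have := h.trans (csInf_le hfin.bddBelow this)
    simp only [Pi.zero_apply]
    linarith
  · intro h
    refine le_csInf ⟨_, hmem (Classical.arbitrary n)⟩ fun c hc => ?_
    obtain ⟨x, hx, hx0⟩ := hc.exists_hasEigenvector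
    rw [Module.End.mem_eigenspace_iff, mulVecLin_apply] at hx
    have := h.dotProduct_mulVec_nonneg x
    rw [sub_mulVec, smul_mulVec, one_mulVec, hx, ← sub_smul, dotProduct_smul, star_trivial,
      smul_eq_mul] at this
    have hpos : 0 < x ⬝ᵥ x := by
      refine lt_of_le_of_ne (Finset.sum_nonneg fun i _ => mul_self_nonneg _) fun e => hx0 ?_
      exact dotProduct_self_eq_zero.1 e.symm
    exact sub_nonneg.1 (nonneg_of_mul_nonneg_left this hpos)

end Matrix

/-! ### Hoffman graphs -/

namespace HoffmanGraph

variable {V : Type u}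

/-- The off-diagonal entries of `B(H)`, as integers. -/
noncomputable def signEntry (H : HoffmanGraph V) (x y : V) : ℤ :=
  open Classical in (if H.graph.Adj x y then 1 else 0) - ((H.fatNbrs x ∩ H.fatNbrs y).ncard : ℤ)

lemma signEntry_comm (H : HoffmanGraph V) (x y : V) : H.signEntry x y = H.signEntry y x := by
  by_cases h : H.graph.Adj x y
  · simp [signEntry, h, h.symm, Set.inter_comm (H.fatNbrs x)]
  · simp [signEntry, h, mt SimpleGraph.Adj.symm h, Set.inter_comm (H.fatNbrs x)]

lemma signEntry_self (H : HoffmanGraph V) (x : V) :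
    H.signEntry x x = -((H.fatNbrs x).ncard : ℤ) := by
  simp [signEntry]

lemma B_apply [Finite V] (H : HoffmanGraph V) (x y : {x // x ∉ H.fat}) :
    H.B x y = H.signEntry x y := by
  classical
  let _ := Fintype.ofFinite {x // x ∈ H.fat}
  have : ((H.fatNbrs x ∩ H.fatNbrs y).ncard : ℝ) =
      ∑ z : {x // x ∈ H.fat}, H.slimFatMatrix x z * H.slimFatMatrix y z := by
    have h1 : H.fatNbrs x ∩ H.fatNbrs y = Subtype.val ''
        {z : {x // x ∈ H.fat} | H.graph.Adj x z ∧ H.graph.Adj y z} := by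
      ext z
      simp only [fatNbrs, Set.mem_inter_iff, Set.mem_ofPred_eq, Set.mem_image, Subtype.exists,
        exists_and_right, exists_eq_right]
      tauto
    rw [h1, Set.ncard_image_of_injective _ Subtype.val_injective, Set.ncard_eq_toFinset_card']
    simp only [slimFatMatrix, Matrix.of_apply, mul_ite, mul_one, mul_zero, ← ite_and]
    rw [Finset.sum_boole]
    congr 2
    ext z
    simp [and_comm]
  simp only [B, Matrix.sub_apply, Matrix.mul_apply, Matrix.transpose_apply, signEntry, slimMatrix,
    Matrix.of_apply]
  push_cast
  rw [this]

lemma isHermitian_B [Finite V] (H : HoffmanGraph V) : H.B.IsHermitian := by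
  ext x y
  simp [B_apply, signEntry_comm H y x]

open Classical in
/-- The matrix `B(H) - α I`. -/
noncomputable def shiftedB [Finite V] (H : HoffmanGraph V) (α : ℝ) :
    Matrix {x // x ∉ H.fat} {x // x ∉ H.fat} ℝ := H.B - α • 1

lemma shiftedB_apply [Finite V] (H : HoffmanGraph V) (α : ℝ) (x y : {x // x ∉ H.fat})
    (hxy : x ≠ y) : H.shiftedB α x y = H.signEntry x y := by
  simp [shiftedB, B_apply, hxy]

lemma shiftedB_self [Finite V] (H : HoffmanGraph V) (α : ℝ) (x : {x // x ∉ H.fat}) :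
    H.shiftedB α x x = -((H.fatNbrs x).ncard : ℝ) - α := by
  simp [shiftedB, B_apply, signEntry_self]

lemma le_lambdaMin_iff [Finite V] (H : HoffmanGraph V) [Nonempty {x // x ∉ H.fat}] (α : ℝ) :
    α ≤ H.lambdaMin ↔ (H.shiftedB α).PosSemidef := by
  classical
  let _ := Fintype.ofFinite {x // x ∉ H.fat}
  rw [lambdaMin, Matrix.posSemidef_sub_smul_one_iff H.isHermitian_B, shiftedB]

/-! ### Block structure and reducibility -/

/-- The slim vertices in `X` together with their fat neighbours. -/
def slimHull (H : HoffmanGraph V) (X : Set V) : Set V :=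
  {w | (w ∉ H.fat ∧ w ∈ X) ∨ (w ∈ H.fat ∧ ∃ y ∈ X, y ∉ H.fat ∧ H.graph.Adj w y)}

lemma mem_slimHull_of_slim (H : HoffmanGraph V) {X : Set V} {x : V} (hx : x ∉ H.fat) :
    x ∈ H.slimHull X ↔ x ∈ X := by
  simp [slimHull, hx]

lemma isHoffmanSet_slimHull (H : HoffmanGraph V) (X : Set V) :
    H.IsHoffmanSet (H.slimHull X) := by
  intro x hx hf
  rcases hx with ⟨h, -⟩ | ⟨-, y, hy, hyf, hadj⟩
  · exact absurd hf h
  · exact ⟨y, (H.mem_slimHull_of_slim hyf).2 hy, hyf, hadj⟩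

lemma fatNbrs_subset_slimHull (H : HoffmanGraph V) {X : Set V} {x : V} (hx : x ∉ H.fat)
    (hX : x ∈ X) : H.fatNbrs x ⊆ H.slimHull X :=
  fun _ hy => Or.inr ⟨hy.1, x, hX, hx, hy.2.symm⟩

/-- Common fat neighbours are in particular fat neighbours of x, so keeping those of x suffices. -/
lemma signEntry_induce (H : HoffmanGraph V) (S : Set V) (hS : H.IsHoffmanSet S) (x y : S)
    (hx : H.fatNbrs x ⊆ S) : (H.induce S hS).signEntry x y = H.signEntry x y := by
  have h : (H.induce S hS).fatNbrs x ∩ (H.induce S hS).fatNbrs y =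
      Subtype.val ⁻¹' (H.fatNbrs x ∩ H.fatNbrs y) := by
    ext z
    simp [fatNbrs, induce]
  rw [signEntry, signEntry, h, Set.ncard_preimage_of_injective_subset_range Subtype.val_injective]
  · have : (H.induce S hS).graph.Adj x y ↔ H.graph.Adj x y := Iff.rfl
    by_cases hadj : H.graph.Adj x y <;> simp [this, hadj]
  · rw [Subtype.range_coe]
    exact Set.inter_subset_left.trans hx

/-- The hull keeps all fat neighbours of its slim vertices, so its matrix is a principal submatrix.
-/
lemma posSemidef_induce_slimHull [Finite V] (H : HoffmanGraph V) {α : ℝ}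
    (h : (H.shiftedB α).PosSemidef) (X : Set V) (hS : H.IsHoffmanSet (H.slimHull X)) :
    ((H.induce (H.slimHull X) hS).shiftedB α).PosSemidef := by
  have hsub : ∀ x : H.slimHull X, (x : V) ∉ H.fat → H.fatNbrs x ⊆ H.slimHull X :=
    fun x hx => H.fatNbrs_subset_slimHull hx ((H.mem_slimHull_of_slim hx).1 x.2)
  obtain ⟨ι, hι⟩ : ∃ ι : {x // x ∉ (H.induce (H.slimHull X) hS).fat} → {x // x ∉ H.fat},
      ∀ x, (ι x : V) = x.1 := ⟨fun x => ⟨x.1.1, x.2⟩, fun _ => rfl⟩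
  convert h.submatrix ι using 1
  ext x y
  rw [Matrix.submatrix_apply]
  by_cases hxy : x = y
  · subst hxy
    simp only [shiftedB, Matrix.sub_apply, B_apply, Matrix.smul_apply, Matrix.one_apply_eq, hι]
    rw [signEntry_induce _ _ _ _ _ (hsub _ x.2)]
  · rw [shiftedB_apply _ _ _ _ hxy, shiftedB_apply _ _ _ _ fun e => hxy
      (Subtype.ext (Subtype.ext (by rw [← hι, ← hι, e]))), hι, hι,
      signEntry_induce _ _ _ _ _ (hsub _ x.2)]

/-- A zero entry says that the number of common fat neighbours equals the adjacency indicator, which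
is the cross condition of a decomposition. -/
lemma cross_of_signEntry_eq_zero [Finite V] (H : HoffmanGraph V) {x y : V}
    (h : H.signEntry x y = 0) : (H.fatNbrs x ∩ H.fatNbrs y).ncard ≤ 1 ∧
      ((H.fatNbrs x ∩ H.fatNbrs y).ncard = 1 ↔ H.graph.Adj x y) := by
  unfold signEntry at h
  split_ifs at h with hadj
  · simp only [hadj, iff_true]; omega
  · simp only [hadj, iff_false]; omega

/-- If `B(H')` is a block diagonal matrix with both blocks meeting the induced Hoffman subgraph
`H`, then `H` is reducible. -/
lemma isReducible_of_blocks [Finite V] (H : HoffmanGraph V) {α : ℝ} (hα : α ≤ H.lambdaMin)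
    {W : Type u} [Finite W] (H' : HoffmanGraph W) (e : H.graph ↪g H'.graph)
    (he : ∀ x, e x ∈ H'.fat ↔ x ∈ H.fat) (hpsd : (H'.shiftedB α).PosSemidef) (X : Set W)
    (hX : ∀ x ∈ X, ∀ y ∉ X, x ∉ H'.fat → y ∉ H'.fat → H'.signEntry x y = 0)
    (h₁ : ∃ x, x ∉ H.fat ∧ e x ∈ X) (h₂ : ∃ x, x ∉ H.fat ∧ e x ∉ X) : H.IsReducible α := by
  have hY : ∀ i j : Fin 2, i ≠ j → (![X, Xᶜ] : Fin 2 → Set W) j = (![X, Xᶜ] i)ᶜ := by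
    intro i j hij
    fin_cases i <;> fin_cases j <;> simp at hij ⊢
  -- A fat vertex may lie in both hulls; only the slim parts have to be disjoint.
  have hdec : H'.IsDecomposition fun i : Fin 2 => H'.slimHull (![X, Xᶜ] i) := by
    refine ⟨fun i => H'.isHoffmanSet_slimHull _, fun x => ?_, fun i j hij x hx hi hj => ?_,
      fun i x hx hxf y hy hxy => ?_, fun i j hij x hx hxf y hy hyf => ?_⟩
    · have aux : ∀ y ∉ H'.fat, ∃ i : Fin 2, y ∈ (![X, Xᶜ] : Fin 2 → Set W) i := fun y _ => by
        by_cases hyX : y ∈ X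
        · exact ⟨0, hyX⟩
        · exact ⟨1, hyX⟩
      by_cases hx : x ∈ H'.fat
      · obtain ⟨y, hy, hxy⟩ := H'.exists_slim_adj x hx
        obtain ⟨i, hi⟩ := aux y hy
        exact ⟨i, Or.inr ⟨hx, y, hi, hy, hxy⟩⟩
      · obtain ⟨i, hi⟩ := aux x hx
        exact ⟨i, Or.inl ⟨hx, hi⟩⟩
    · rw [mem_slimHull_of_slim _ hx] at hi hj
      rw [hY i j hij] at hj
      exact hj hi
    · exact H'.fatNbrs_subset_slimHull hxf ((H'.mem_slimHull_of_slim hxf).1 hx) ⟨hy, hxy⟩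
    · rw [mem_slimHull_of_slim _ hxf] at hx
      rw [mem_slimHull_of_slim _ hyf, hY i j hij] at hy
      refine H'.cross_of_signEntry_eq_zero ?_
      fin_cases i
      · exact hX x hx y hy hxf hyf
      · rw [signEntry_comm]
        exact hX y (not_not.1 hy) x hx hyf hxf
  refine ⟨hα, W, ‹_›, H', e, _, hdec, he, fun i => ?_⟩
  have hex : ∃ x, x ∉ H.fat ∧ e x ∈ H'.slimHull (![X, Xᶜ] i) := by
    have : ∃ x, x ∉ H.fat ∧ e x ∈ (![X, Xᶜ] : Fin 2 → Set W) i := by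
      fin_cases i
      · exact h₁
      · exact h₂
    obtain ⟨x, hx, hxi⟩ := this
    exact ⟨x, hx, (H'.mem_slimHull_of_slim (mt (he x).1 hx)).2 hxi⟩
  refine ⟨?_, hex⟩
  obtain ⟨x, hx, hxi⟩ := hex
  have : Nonempty {x // x ∉ (H'.induce _ (hdec.isHoffmanSet i)).fat} :=
    ⟨⟨⟨e x, hxi⟩, mt (he x).1 hx⟩⟩
  rw [le_lambdaMin_iff]
  exact H'.posSemidef_induce_slimHull hpsd _ _

/-- The special graph of an irreducible Hoffman graph is connected. -/
lemma IsIrreducible.exists_signEntry_ne_zero [Finite V] {H : HoffmanGraph V} {α : ℝ}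
    (h : H.IsIrreducible α) (X : Set {x // x ∉ H.fat}) (hX : X.Nonempty) (hX' : X ≠ Set.univ) :
    ∃ x ∈ X, ∃ y ∉ X, H.signEntry y x ≠ 0 := by
  by_contra! hno
  obtain ⟨x, hx⟩ := hX
  obtain ⟨y, hy⟩ := (Set.ne_univ_iff_exists_notMem X).1 hX'
  have : Nonempty {x // x ∉ H.fat} := ⟨x⟩
  -- The enclosing graph is H itself.
  refine h.2 (H.isReducible_of_blocks h.1 H (SimpleGraph.Embedding.refl) (fun _ => Iff.rfl)
    ((H.le_lambdaMin_iff α).1 h.1) (Subtype.val '' X) ?_ ⟨x, x.2, x, hx, rfl⟩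
    ⟨y, y.2, ?_⟩)
  · rintro _ ⟨a, ha, rfl⟩ b hb - hbf
    rw [signEntry_comm]
    exact hno a ha ⟨b, hbf⟩ fun hb' => hb ⟨_, hb', rfl⟩
  · rintro ⟨z, hz, e⟩
    exact hy (Subtype.ext e ▸ hz)

/-- The bound on fat neighbours is essential: an adjacent pair with two common fat neighbours has
entry -1 without being a (-)-edge. -/
lemma specialGraph_adj_iff [Finite V] (H : HoffmanGraph V) {x y : {x // x ∉ H.fat}} (hxy : x ≠ y)
    (h : (H.fatNbrs x).ncard ≤ 1) :
    (H.specialGraph.pos.Adj x y ↔ H.signEntry x y = 1) ∧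
      (H.specialGraph.neg.Adj x y ↔ H.signEntry x y = -1) := by
  have h1 : (H.fatNbrs x ∩ H.fatNbrs y).ncard ≤ 1 :=
    (Set.ncard_le_ncard Set.inter_subset_left).trans h
  have h2 : H.fatNbrs x ∩ H.fatNbrs y = ∅ ↔ (H.fatNbrs x ∩ H.fatNbrs y).ncard = 0 :=
    (Set.ncard_eq_zero).symm
  simp only [specialGraph, signEntry, Set.nonempty_iff_ne_empty, Ne, h2, hxy, not_false_eq_true,
    true_and]
  split_ifs with hadj <;> simp only [hadj, true_and, false_and, not_true_eq_false, false_iff,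
    not_false_eq_true] <;> omega

end HoffmanGraph

/-! ### Isomorphisms of edge-signed graphs -/

namespace EdgeSignedGraph

variable {α : Type*} {β : Type*}

lemma isomorphic_of_bijective {S : EdgeSignedGraph α} {T : EdgeSignedGraph β} (f : β → α)
    (hf : f.Bijective) (h : ∀ i j, i ≠ j → (T.pos.Adj i j ↔ S.pos.Adj (f i) (f j)) ∧
      (T.neg.Adj i j ↔ S.neg.Adj (f i) (f j))) : S.Isomorphic T := by
  refine ⟨(Equiv.ofBijective f hf).symm, fun x y => ?_⟩
  obtain ⟨i, rfl⟩ := hf.surjective x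
  obtain ⟨j, rfl⟩ := hf.surjective y
  simp only [Equiv.ofBijective_symm_apply_apply]
  by_cases hij : i = j
  · subst hij; simp
  · exact ⟨(h i j hij).1.symm, (h i j hij).2.symm⟩

/-- The sign of a pair in the edge-signed graph `ofEdges P N`. -/
def edgeSign {n : ℕ} (P N : List (Fin n × Fin n)) (i j : Fin n) : ℤ :=
  if (i, j) ∈ P ∨ (j, i) ∈ P then 1 else if (i, j) ∈ N ∨ (j, i) ∈ N then -1 else 0

lemma ofEdges_adj_iff {n : ℕ} (P N : List (Fin n × Fin n)) {i j : Fin n} (hij : i ≠ j) :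
    ((ofEdges P N).pos.Adj i j ↔ edgeSign P N i j = 1) ∧
      ((ofEdges P N).neg.Adj i j ↔ edgeSign P N i j = -1) := by
  simp only [ofEdges, SimpleGraph.fromRel_adj, SimpleGraph.sdiff_adj, edgeSign]
  split_ifs <;> simp_all

/-- The edge-signed graph `S` has the signs `σ`. -/
def HasSigns (S : EdgeSignedGraph α) (σ : α → α → ℤ) : Prop :=
  ∀ x y, x ≠ y → (S.pos.Adj x y ↔ σ x y = 1) ∧ (S.neg.Adj x y ↔ σ x y = -1)

lemma HasSigns.isomorphic_ofEdges {S : EdgeSignedGraph α} {σ : α → α → ℤ} (hS : S.HasSigns σ)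
    (hσ : ∀ x y, σ x y = σ y x) {vs : List α} (hvs : vs.Nodup) (hall : ∀ x, x ∈ vs) {n : ℕ}
    (g : List (List ℤ)) (hn : g.length = n) (hg : upperRows σ vs = g)
    (P N : List (Fin n × Fin n)) (h : ∀ i j, i ≠ j → edgeSign P N i j = rowsEntry g i j) :
    S.Isomorphic (ofEdges P N) := by
  classical
  subst hg
  rw [length_upperRows] at hn
  subst hn
  refine isomorphic_of_bijective _ (hvs.getEquivOfForallMemList vs hall).bijective
    fun i j hij => ?_
  have hne : vs.get i ≠ vs.get j := fun e => hij (hvs.injective_get e)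
  have h1 := h i j hij
  rw [rowsEntry_upperRows σ hσ vs i j i.2 j.2 (by simpa [Fin.ext_iff] using hij)] at h1
  have h2 := hS _ _ hne
  have h3 := ofEdges_adj_iff P N hij
  rw [h1] at h3
  exact ⟨h3.1.trans h2.1.symm, h3.2.trans h2.2.symm⟩

lemma HasSigns.exceptional_of_mem {S : EdgeSignedGraph α} {σ : α → α → ℤ} (hS : S.HasSigns σ)
    (hσ : ∀ x y, σ x y = σ y x) {vs : List α} (hvs : vs.Nodup) (hall : ∀ x, x ∈ vs)
    (h : upperRows σ vs ∈ exceptionalRowsThree ++ exceptionalRowsFour ++ exceptionalRowsFive ++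
      exceptionalRowsSix ++ [rowsS63]) : ∃ T ∈ exceptional, S.Isomorphic T.2 := by
  have key : ∀ (g : List (List ℤ)) (n : ℕ) (P N : List (Fin n × Fin n)),
      upperRows σ vs = g → g.length = n → (∀ i j, i ≠ j → edgeSign P N i j = rowsEntry g i j) →
      S.Isomorphic (ofEdges P N) := fun g n P N hg hn he =>
    hS.isomorphic_ofEdges hσ hvs hall g hn hg P N he
  simp only [exceptionalRowsThree, exceptionalRowsFour, exceptionalRowsFive, exceptionalRowsSix,
    rowsS63, List.mem_append, List.mem_cons, List.not_mem_nil, or_false, or_assoc] at h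
  simp only [exceptional, List.mem_cons, List.not_mem_nil, or_false, exists_eq_or_imp,
    exists_eq_left]
  -- The tables follow the order and the vertex numbering of `exceptional`.
  refine h.imp (fun h => key _ _ _ _ h rfl (by decide +kernel)) fun h => ?_
  refine h.imp (fun h => key _ _ _ _ h rfl (by decide +kernel)) fun h => ?_
  refine h.imp (fun h => key _ _ _ _ h rfl (by decide +kernel)) fun h => ?_
  refine h.imp (fun h => key _ _ _ _ h rfl (by decide +kernel)) fun h => ?_
  refine h.imp (fun h => key _ _ _ _ h rfl (by decide +kernel)) fun h => ?_
  refine h.imp (fun h => key _ _ _ _ h rfl (by decide +kernel)) fun h => ?_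
  refine h.imp (fun h => key _ _ _ _ h rfl (by decide +kernel)) fun h => ?_
  refine h.imp (fun h => key _ _ _ _ h rfl (by decide +kernel)) fun h => ?_
  refine h.imp (fun h => key _ _ _ _ h rfl (by decide +kernel)) fun h => ?_
  refine h.imp (fun h => key _ _ _ _ h rfl (by decide +kernel)) fun h => ?_
  refine h.imp (fun h => key _ _ _ _ h rfl (by decide +kernel)) fun h => ?_
  refine h.imp (fun h => key _ _ _ _ h rfl (by decide +kernel)) fun h => ?_
  refine h.imp (fun h => key _ _ _ _ h rfl (by decide +kernel)) fun h => ?_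
  exact h.imp (fun h => key _ _ _ _ h rfl (by decide +kernel))
    fun h => key _ _ _ _ h rfl (by decide +kernel)

lemma isomorphic_Q_one (S : EdgeSignedGraph α) (x : α) (h : ∀ z, z = x) :
    S.Isomorphic (Q 0 0 1) := by
  refine isomorphic_of_bijective (fun _ => x) ⟨?_, fun z => ⟨.inr (.inr 0), (h z).symm⟩⟩ ?_
  · rintro (i | i | i) (j | j | j) - <;> first | exact i.elim0 | exact j.elim0 | skip
    rw [Subsingleton.elim i j]
  · rintro (i | i | i) (j | j | j) hij <;> first | exact i.elim0 | exact j.elim0 | skip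
    exact absurd (by rw [Subsingleton.elim i j]) hij

lemma isomorphic_Q_pos (S : EdgeSignedGraph α) {x y : α} (h : ∀ z, z = x ∨ z = y)
    (hxy : S.pos.Adj x y) : S.Isomorphic (Q 1 0 1) := by
  have hneg : ¬ S.neg.Adj x y := SimpleGraph.disjoint_left.1 S.disjoint x y hxy
  refine isomorphic_of_bijective (Sum.elim (fun _ => x) fun _ => y) ⟨?_, fun z => ?_⟩ ?_
  · rintro (i | i | i) (j | j | j) hij <;>
      first | exact i.elim0 | exact j.elim0 | rw [Subsingleton.elim i j]
    · exact absurd hij hxy.ne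
    · exact absurd hij hxy.ne'
  · rcases h z with rfl | rfl
    · exact ⟨.inl 0, rfl⟩
    · exact ⟨.inr (.inr 0), rfl⟩
  · rintro (i | i | i) (j | j | j) hij <;>
      first | exact i.elim0 | exact j.elim0 | (refine absurd ?_ hij; rw [Subsingleton.elim i j]; done) | skip
    · simp [Q, QPos, QNeg, hxy, hneg, Subsingleton.elim i 0, Subsingleton.elim j 0]
    · simp [Q, QPos, QNeg, hxy.symm, mt SimpleGraph.Adj.symm hneg, Subsingleton.elim i 0,
        Subsingleton.elim j 0]

lemma isomorphic_Q_neg (S : EdgeSignedGraph α) {x y : α} (h : ∀ z, z = x ∨ z = y)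
    (hxy : S.neg.Adj x y) : S.Isomorphic (Q 0 1 1) := by
  have hpos : ¬ S.pos.Adj x y := SimpleGraph.disjoint_left.1 S.disjoint.symm x y hxy
  refine isomorphic_of_bijective
    (Sum.elim (fun _ => x) (Sum.elim (fun _ => x) fun _ => y)) ⟨?_, fun z => ?_⟩ ?_
  · rintro (i | i | i) (j | j | j) hij <;>
      first | exact i.elim0 | exact j.elim0 | rw [Subsingleton.elim i j]
    · exact absurd hij hxy.ne
    · exact absurd hij hxy.ne'
  · rcases h z with rfl | rfl
    · exact ⟨.inr (.inl 0), rfl⟩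
    · exact ⟨.inr (.inr 0), rfl⟩
  · rintro (i | i | i) (j | j | j) hij <;>
      first | exact i.elim0 | exact j.elim0 | (refine absurd ?_ hij; rw [Subsingleton.elim i j]; done) | skip
    · simp [Q, QPos, QNeg, hxy, hpos, Subsingleton.elim i 0, Subsingleton.elim j 0]
    · simp [Q, QPos, QNeg, hxy.symm, mt SimpleGraph.Adj.symm hpos, Subsingleton.elim i 0,
        Subsingleton.elim j 0]

/-- A connected sign system that comes from a partition of the vertices into classes, with negative
edges inside and positive edges between classes, is small or a clique with pendant edges. -/
theorem HasSigns.classification [Finite α] [Nonempty α] {S : EdgeSignedGraph α} {σ : α → α → ℤ}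
    (hS : S.HasSigns σ) (h : IsSignSystem σ) (hno : ¬ IsPendantClique σ) (c : α → β)
    (hneg : ∀ x y, x ≠ y → σ x y = -1 → c x = c y) (hpos : ∀ x y, x ≠ y → σ x y = 1 → c x ≠ c y) :
    S.Isomorphic (Q 0 0 1) ∨ S.Isomorphic (Q 1 0 1) ∨ S.Isomorphic (Q 0 1 1) ∨
      ∃ T ∈ exceptional, S.Isomorphic T.2 := by
  obtain ⟨vs, hvs, hall, hmem⟩ := h.classification hno
  rw [List.mem_append] at hmem
  rcases hmem with hmem | hmem
  · simp only [rowsOne, rowsTwo, cycleRowsFour, cycleRowsFive, List.mem_append, List.mem_cons,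
      List.not_mem_nil, or_false, or_assoc] at hmem
    rcases hmem with hg | hg | hg | hg | hg <;>
      have hl := congrArg List.length hg <;> rw [length_upperRows] at hl
    · obtain ⟨x, rfl⟩ := List.length_eq_one_iff.1 hl
      exact Or.inl (S.isomorphic_Q_one x (by simpa using hall))
    · obtain ⟨x, y, rfl⟩ := List.length_eq_two.1 hl
      simp only [List.nodup_cons, List.mem_singleton] at hvs
      refine Or.inr (Or.inl (S.isomorphic_Q_pos (by simpa using hall) ((hS x y hvs.1).1.2 ?_)))
      simpa [upperRows] using hg
    · obtain ⟨x, y, rfl⟩ := List.length_eq_two.1 hl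
      simp only [List.nodup_cons, List.mem_singleton] at hvs
      refine Or.inr (Or.inr (Or.inl (S.isomorphic_Q_neg (by simpa using hall)
        ((hS x y hvs.1).2.2 ?_))))
      simpa [upperRows] using hg
    · obtain ⟨a, b, d, e, rfl⟩ := List.length_eq_four.1 hl
      simp only [upperRows, List.map_cons, List.map_nil, List.cons.injEq, and_true] at hg
      simp only [List.nodup_cons, List.mem_cons, List.not_mem_nil, or_false, not_or] at hvs
      -- The negative path puts both its ends in one class, whereas the positive edge separates
      -- them.
      have h1 := hneg a b hvs.1.1 hg.1.1
      have h2 := hneg b d hvs.2.1.1 hg.2.1.1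
      have h3 := hneg d e hvs.2.2.1 hg.2.2
      exact absurd (h1.trans (h2.trans h3)) (hpos a e hvs.1.2.2 hg.1.2.2)
    · obtain ⟨a, vs, rfl⟩ := List.exists_cons_of_length_eq_add_one hl
      obtain ⟨b, d, e, f, rfl⟩ := List.length_eq_four.1 (Nat.succ.inj hl)
      simp only [upperRows, List.map_cons, List.map_nil, List.cons.injEq, and_true] at hg
      simp only [List.nodup_cons, List.mem_cons, List.not_mem_nil, or_false, not_or] at hvs
      have h1 := hneg a b hvs.1.1 hg.1.1
      have h2 := hneg b d hvs.2.1.1 hg.2.1.1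
      have h3 := hneg d e hvs.2.2.1.1 hg.2.2.1.1
      have h4 := hneg e f hvs.2.2.2.1 hg.2.2.2
      exact absurd (h1.trans (h2.trans (h3.trans h4))) (hpos a f hvs.1.2.2.2 hg.1.2.2.2)
  · exact Or.inr (Or.inr (Or.inr (hS.exceptional_of_mem h.symm hvs hall hmem)))

end EdgeSignedGraph

/-! ### Quadratic forms along lists of vertices -/

/-- The vector with coordinates `xs` along the list of vertices `vs`. -/
noncomputable def listVector {α : Type*} [DecidableEq α] : List α → List ℤ → α → ℝ
  | v :: vs, x :: xs => (x : ℝ) • Pi.single v 1 + listVector vs xs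
  | _, _ => 0

lemma cast_listDot {α : Type*} [Fintype α] [DecidableEq α] (N : Matrix α α ℝ) (σ : α → α → ℤ)
    (hN : ∀ v w, v ≠ w → N v w = 8 * σ v w) (v : α) (vs : List α) (hv : v ∉ vs) (xs : List ℤ) :
    (listDot ((vs.map (σ v)).map (8 * ·)) xs : ℝ) = N.mulVec (listVector vs xs) v := by
  induction vs generalizing xs with
  | nil => simp [listDot, listVector]
  | cons w vs ih =>
    cases xs with
    | nil => simp [listDot, listVector]
    | cons x xs =>
      rw [List.mem_cons, not_or] at hv
      simp only [List.map_cons, listDot, listVector, Matrix.mulVec_add, Matrix.mulVec_smul,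
        Matrix.mulVec_single_one, Pi.add_apply, Pi.smul_apply, Matrix.col_apply, smul_eq_mul]
      push_cast
      rw [ih hv.2, hN v w hv.1]
      ring

lemma cast_triForm {α : Type*} [Fintype α] [DecidableEq α] (N : Matrix α α ℝ) (σ : α → α → ℤ)
    (hsymm : ∀ v w, N v w = N w v) (hdiag : ∀ v, N v v = 13)
    (hN : ∀ v w, v ≠ w → N v w = 8 * σ v w) (vs : List α) (hvs : vs.Nodup) (xs : List ℤ) :
    (triForm (shiftedRows (upperRows σ vs)) xs : ℝ) =
      listVector vs xs ⬝ᵥ N.mulVec (listVector vs xs) := by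
  induction vs generalizing xs with
  | nil => simp [triForm, listVector, shiftedRows, upperRows]
  | cons v vs ih =>
    cases xs with
    | nil => simp [triForm, listVector, shiftedRows, upperRows]
    | cons x xs =>
      rw [List.nodup_cons] at hvs
      have hcol : listVector vs xs ⬝ᵥ N.col v = N.mulVec (listVector vs xs) v := by
        rw [dotProduct_comm]
        simp [Matrix.mulVec, dotProduct, hsymm v]
      have h1 := ih hvs.2 xs
      simp only [shiftedRows] at h1
      simp only [shiftedRows, upperRows, List.map_cons, triForm, listVector, Matrix.mulVec_add,
        Matrix.mulVec_smul, Matrix.mulVec_single_one, add_dotProduct, dotProduct_add,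
        smul_dotProduct, dotProduct_smul, single_one_dotProduct, smul_eq_mul, hcol,
        Matrix.col_apply, hdiag]
      push_cast
      rw [h1, cast_listDot N σ hN v vs hvs.1 xs]
      ring

/-! ### Reduction by a new fat vertex -/

namespace HoffmanGraph

variable {V : Type u}

/-- The Hoffman graph obtained by joining one new fat vertex to the slim vertices in `K`. -/
def addFat (H : HoffmanGraph V) (K : Set V) (hK : K.Nonempty) (hslim : ∀ x ∈ K, x ∉ H.fat) :
    HoffmanGraph (Option V) where
  graph :=
    { Adj := fun
        | some x, some y => H.graph.Adj x y
        | some x, none => x ∈ K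
        | none, some y => y ∈ K
        | none, none => False
      symm := ⟨by
        rintro (_ | x) (_ | y) h
        · exact h
        · exact h
        · exact h
        · exact SimpleGraph.Adj.symm h⟩
      loopless := ⟨by
        rintro (_ | x) h
        · exact h
        · exact SimpleGraph.irrefl _ h⟩ }
  -- The new vertex `none` satisfies this vacuously.
  fat := {o | ∀ x ∈ o, x ∈ H.fat}
  exists_slim_adj := by
    rintro (_ | x) hx
    · obtain ⟨k, hk⟩ := hK
      exact ⟨some k, fun h => hslim k hk (h k rfl), hk⟩
    · obtain ⟨y, hy, hxy⟩ := H.exists_slim_adj x (hx x rfl)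
      exact ⟨some y, fun h => hy (h y rfl), hxy⟩
  fat_not_adj := by
    rintro (_ | x) hx (_ | y) hy h
    · exact h
    · exact hslim y h (hy y rfl)
    · exact hslim x h (hx x rfl)
    · exact H.fat_not_adj x (hx x rfl) y (hy y rfl) h

section addFat

variable (H : HoffmanGraph V) (K : Set V) (hK : K.Nonempty) (hslim : ∀ x ∈ K, x ∉ H.fat)

lemma some_mem_addFat_fat (x : V) : some x ∈ (H.addFat K hK hslim).fat ↔ x ∈ H.fat := by
  simp [addFat]

-- On slim vertices, B changes by minus the all-ones block on K, which cancels a positive clique off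
-- the diagonal.
open Classical in
lemma signEntry_addFat [Finite V] (x y : V) : (H.addFat K hK hslim).signEntry (some x) (some y) =
    H.signEntry x y - if x ∈ K ∧ y ∈ K then 1 else 0 := by
  have hadj : (H.addFat K hK hslim).graph.Adj (some x) (some y) ↔ H.graph.Adj x y := Iff.rfl
  have hinter : (H.addFat K hK hslim).fatNbrs (some x) ∩ (H.addFat K hK hslim).fatNbrs (some y) =
      some '' (H.fatNbrs x ∩ H.fatNbrs y) ∪ {o | o = none ∧ x ∈ K ∧ y ∈ K} := by
    ext (_ | z)
    · simp [fatNbrs, addFat]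
    · simp [fatNbrs, addFat]
  have hcard : ((H.addFat K hK hslim).fatNbrs (some x) ∩
      (H.addFat K hK hslim).fatNbrs (some y)).ncard = (H.fatNbrs x ∩ H.fatNbrs y).ncard +
        if x ∈ K ∧ y ∈ K then 1 else 0 := by
    rw [hinter, Set.ncard_union_eq (by
      rw [Set.disjoint_left]
      rintro _ ⟨z, -, rfl⟩ h
      exact Option.some_ne_none z h.1),
      Set.ncard_image_of_injective _ (Option.some_injective V)]
    split_ifs with h
    · simp [h]
    · simp [h]
  rw [signEntry, signEntry, hcard]
  simp only [hadj]
  push_cast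
  ring

end addFat

lemma signEntry_cases [Finite V] (H : HoffmanGraph V) {x : V} (h : (H.fatNbrs x).ncard ≤ 1)
    (y : V) : H.signEntry x y = 0 ∨ H.signEntry x y = 1 ∨ H.signEntry x y = -1 := by
  have h1 : (H.fatNbrs x ∩ H.fatNbrs y).ncard ≤ 1 :=
    (Set.ncard_le_ncard Set.inter_subset_left).trans h
  unfold signEntry
  split_ifs <;> omega

/-- A Hoffman graph whose special graph is a clique with pendant edges becomes decomposable after
joining a new fat vertex to the clique. -/
theorem isReducible_of_isPendantClique [Finite V] (H : HoffmanGraph V)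
    (hone : ∀ x, x ∉ H.fat → (H.fatNbrs x).ncard = 1)
    (hH : IsPendantClique fun x y : {x // x ∉ H.fat} => H.signEntry x y) :
    H.IsReducible (-1 - Real.goldenRatio) := by
  classical
  obtain ⟨π, h1, h2, h3, h4, k, l, hkl, hk, hl⟩ := hH
  beta_reduce at h2 h3
  set K : Set V := {x | ∃ hx : x ∉ H.fat, π ⟨x, hx⟩ = ⟨x, hx⟩} with hKdef
  have hmem : ∀ x : {x // x ∉ H.fat}, (x : V) ∈ K ↔ π x = x := fun x =>
    ⟨fun ⟨_, h⟩ => h, fun h => ⟨x.2, h⟩⟩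
  have hKne : K.Nonempty := ⟨k, (hmem k).2 hk⟩
  have hKs : ∀ x ∈ K, x ∉ H.fat := fun x hx => hx.1
  set H' := H.addFat K hKne hKs with hH'
  have hfat : ∀ x, some x ∈ H'.fat ↔ x ∈ H.fat := H.some_mem_addFat_fat K hKne hKs
  have hsign : ∀ x y : {x // x ∉ H.fat}, H'.signEntry (some (x : V)) (some (y : V)) =
      H.signEntry x y - if π x = x ∧ π y = y then 1 else 0 := fun x y => by
    rw [hH', signEntry_addFat]
    simp only [hmem]
  have hzero : ∀ x y : {x // x ∉ H.fat}, π x = x → π y = y → x ≠ y →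
      H'.signEntry (some (x : V)) (some (y : V)) = 0 := fun x y hx hy hxy => by
    rw [hsign, h2 x y hx hy hxy, if_pos ⟨hx, hy⟩, sub_self]
  have hzero' : ∀ x y : {x // x ∉ H.fat}, π x ≠ π y →
      H'.signEntry (some (x : V)) (some (y : V)) = 0 := fun x y hxy => by
    by_cases hb : π x = x ∧ π y = y
    · exact hzero x y hb.1 hb.2 fun e => hxy (by rw [e])
    · rw [hsign, h3 x y hb hxy, if_neg hb, sub_self]
  obtain ⟨ι, hι⟩ : ∃ ι : {o // o ∉ H'.fat} → {x // x ∉ H.fat}, ∀ o, some (ι o : V) = o.1 := by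
    have : ∀ o : {o // o ∉ H'.fat}, ∃ x : {x // x ∉ H.fat}, some (x : V) = o.1 := by
      rintro ⟨_ | x, ho⟩
      · exact absurd (by intro x hx; simp at hx) ho
      · exact ⟨⟨x, mt (hfat x).2 ho⟩, rfl⟩
    choose ι hι using this
    exact ⟨ι, hι⟩
  have hιinj : ι.Injective := fun a b hab => Subtype.ext (by rw [← hι a, ← hι b, hab])
  set α := -1 - Real.goldenRatio with hα
  have hφ := Real.goldenRatio_sq
  have hφ1 := Real.one_lt_goldenRatio
  have hdiag : ∀ a, H'.shiftedB α a a =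
      Real.goldenRatio - if π (ι a) = ι a then 1 else 0 := fun a => by
    have h5 := H'.signEntry_self a.1
    rw [← hι a, hsign, signEntry_self, hone _ (ι a).2] at h5
    have h6 : ((H'.fatNbrs a).ncard : ℝ) = 1 + if π (ι a) = ι a then 1 else 0 := by
      rw [← hι a]
      have h7 : ((H'.fatNbrs (some (ι a : V))).ncard : ℤ) =
          1 + if π (ι a) = ι a then 1 else 0 := by
        simp only [and_self] at h5
        push_cast at h5
        linarith
      split_ifs at h7 ⊢ <;> exact_mod_cast h7
    rw [shiftedB_self, h6, hα]
    ring
  have hoff : ∀ a b, a ≠ b → H'.shiftedB α a b =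
      H'.signEntry (some (ι a : V)) (some (ι b : V)) := fun a b hab => by
    rw [shiftedB_apply _ _ _ _ hab, hι, hι]
  have hoff0 : ∀ a b, a ≠ b → H'.shiftedB α a b ≠ 0 →
      π (ι a) = π (ι b) ∧ ¬ (π (ι a) = ι a ∧ π (ι b) = ι b) := fun a b hab h0 => by
    rw [hoff a b hab] at h0
    refine ⟨?_, fun hb => ?_⟩
    · by_contra hne
      exact h0 (by rw [hzero' _ _ hne, Int.cast_zero])
    · exact h0 (by rw [hzero _ _ hb.1 hb.2 (hιinj.ne hab), Int.cast_zero])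
  have hdiag0 : ∀ a, 0 ≤ H'.shiftedB α a a := fun a => by
    rw [hdiag]
    split_ifs <;> linarith
  let _ := Fintype.ofFinite {o // o ∉ H'.fat}
  have hpsd : (H'.shiftedB α).PosSemidef := by
    refine Matrix.posSemidef_of_unique_partner _ (fun a b => ?_) hdiag0 (fun a b hab => ?_)
      fun a b c hb hc hab hac => ?_
    · by_cases hab : a = b
      · rw [hab]
      · rw [shiftedB_apply _ _ _ _ hab, shiftedB_apply _ _ _ _ (Ne.symm hab), signEntry_comm]
    · by_cases h0 : H'.shiftedB α a b = 0
      · rw [h0]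
        have := mul_nonneg (hdiag0 a) (hdiag0 b)
        simpa using this
      obtain ⟨h5, h6⟩ := hoff0 a b hab h0
      have h7 : H'.shiftedB α a b ^ 2 ≤ 1 := by
        rw [hoff a b hab, hsign, if_neg h6, sub_zero]
        rcases H.signEntry_cases (hone _ (ι a).2).le (ι b) with h | h | h <;> rw [h] <;> norm_num
      have h8 : ¬ (π (ι a) ≠ ι a ∧ π (ι b) ≠ ι b) := fun h8 =>
        hιinj.ne hab (h4 _ _ h8.1 h8.2 h5)
      -- One vertex lies in the clique and the other does not, so the diagonal product is (τ-1)τ =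
      -- 1.
      refine h7.trans_eq ?_
      rw [hdiag, hdiag]
      by_cases ha : π (ι a) = ι a
      · have hb : ¬ π (ι b) = ι b := fun hb => h6 ⟨ha, hb⟩
        rw [if_pos ha, if_neg hb]
        linarith
      · have hb : π (ι b) = ι b := by
          by_contra hb
          exact h8 ⟨ha, hb⟩
        rw [if_neg ha, if_pos hb]
        linarith
    · obtain ⟨h5, h6⟩ := hoff0 a b (Ne.symm hb) hab
      obtain ⟨h7, h8⟩ := hoff0 a c (Ne.symm hc) hac
      refine hιinj ?_
      by_cases ha : π (ι a) = ι a
      · exact h4 _ _ (fun e => h6 ⟨ha, e⟩) (fun e => h8 ⟨ha, e⟩) (h5.symm.trans h7)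
      · have hb' : π (ι b) = ι b := by
          by_contra e
          exact hb (hιinj (h4 _ _ e ha h5.symm))
        have hc' : π (ι c) = ι c := by
          by_contra e
          exact hc (hιinj (h4 _ _ e ha h7.symm))
        rw [← hb', ← hc', ← h5, ← h7]
  obtain ⟨κ, hκ⟩ : ∃ κ : {x // x ∉ H.fat} → {o // o ∉ H'.fat}, ∀ x, ι (κ x) = x := by
    refine ⟨fun x => ⟨some x.1, mt (hfat x).1 x.2⟩, fun x => Subtype.ext ?_⟩
    exact Option.some_injective V (hι _)
  have hκinj : κ.Injective := fun a b hab => by rw [← hκ a, ← hκ b, hab]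
  have hpsdH : (H.shiftedB α).PosSemidef := by
    -- Undoing the extension adds the rank-one matrix of the indicator of the clique, so H satisfies
    -- the bound as well.
    have h5 : H.shiftedB α = (H'.shiftedB α).submatrix κ κ +
        Matrix.vecMulVec (fun x => if π x = x then (1 : ℝ) else 0)
          (star fun x => if π x = x then (1 : ℝ) else 0) := by
      ext x y
      rw [Matrix.add_apply, Matrix.submatrix_apply, Matrix.vecMulVec_apply]
      by_cases hxy : x = y
      · subst hxy
        rw [hdiag, hκ, shiftedB_self, hone _ x.2, hα]
        simp only [Pi.star_apply, star_trivial]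
        split_ifs <;> push_cast <;> ring
      · rw [hoff _ _ (hκinj.ne hxy), hκ, hκ, hsign, shiftedB_apply _ _ _ _ hxy]
        simp only [Pi.star_apply, star_trivial]
        by_cases hx : π x = x <;> by_cases hy : π y = y <;> simp [hx, hy]
    rw [h5]
    exact (hpsd.submatrix κ).add (Matrix.posSemidef_vecMulVec_self_star _)
  have : Nonempty {x // x ∉ H.fat} := ⟨k⟩
  have hval : ∀ o, o ∉ H'.fat → ∃ x : {x // x ∉ H.fat}, some (x : V) = o :=
    fun o ho => ⟨ι ⟨o, ho⟩, hι ⟨o, ho⟩⟩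
  -- One block is the fibre of π over k; the second clique vertex l lies outside it.
  refine H.isReducible_of_blocks ((H.le_lambdaMin_iff α).2 hpsdH) H'
    ⟨⟨some, Option.some_injective V⟩, Iff.rfl⟩ hfat hpsd
    {o | ∃ x : {x // x ∉ H.fat}, some (x : V) = o ∧ π x = k} ?_ ⟨k, k.2, k, rfl, hk⟩
    ⟨l, l.2, ?_⟩
  · rintro _ ⟨x, rfl, hx⟩ o ho - hof
    obtain ⟨y, rfl⟩ := hval o hof
    exact hzero' x y fun e => ho ⟨y, rfl, by rw [← e, hx]⟩
  · rintro ⟨x, hx, hxk⟩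
    obtain rfl : x = l := Subtype.ext (Option.some_injective V hx)
    exact hkl (hxk.symm.trans hl)

end HoffmanGraph

/-! ### Irreducible graphs: one or two fat neighbours -/

namespace HoffmanGraph

variable {V : Type u}

section irreducible

variable [Finite V] {H : HoffmanGraph V}

lemma IsIrreducible.posSemidef {α : ℝ} (h : H.IsIrreducible α) [Nonempty {x // x ∉ H.fat}] :
    (H.shiftedB α).PosSemidef :=
  (H.le_lambdaMin_iff α).1 h.1

lemma ncard_fatNbrs_le_two (h : (H.shiftedB (-1 - Real.goldenRatio)).PosSemidef)
    (x : {x // x ∉ H.fat}) : (H.fatNbrs x).ncard ≤ 2 := by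
  have h1 := h.diag_nonneg (i := x)
  rw [shiftedB_self] at h1
  have h2 := Real.goldenRatio_lt_two
  have h3 : ((H.fatNbrs x).ncard : ℝ) < 3 := by linarith
  have h4 : (H.fatNbrs x).ncard < 3 := by exact_mod_cast h3
  omega

/-- Nonnegativity of the principal minor on x, y. -/
lemma signEntry_sq_le (h : (H.shiftedB (-1 - Real.goldenRatio)).PosSemidef)
    {x y : {x // x ∉ H.fat}} (hxy : x ≠ y) :
    (H.signEntry x y : ℝ) ^ 2 ≤ (1 + Real.goldenRatio - (H.fatNbrs x).ncard) *
      (1 + Real.goldenRatio - (H.fatNbrs y).ncard) := by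
  have h1 := (h.submatrix ![x, y]).det_nonneg
  rw [Matrix.det_fin_two] at h1
  simp only [Matrix.submatrix_apply, Matrix.cons_val_zero, Matrix.cons_val_one,
    shiftedB_apply _ _ _ _ hxy, shiftedB_apply _ _ _ _ hxy.symm, shiftedB_self,
    signEntry_comm H y x] at h1
  linarith

/-- A slim vertex with two fat neighbours and a neighbour in the special graph form a connected
component of the special graph, since they carry an irrational null vector. -/
lemma signEntry_of_two (h : (H.shiftedB (-1 - Real.goldenRatio)).PosSemidef)
    (hfat : H.IsFat) {x y : {x // x ∉ H.fat}} (hxy : x ≠ y) (hx : (H.fatNbrs x).ncard = 2)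
    (h0 : H.signEntry x y ≠ 0) : (H.fatNbrs y).ncard = 1 ∧
      (H.signEntry x y = 1 ∨ H.signEntry x y = -1) ∧
      ∀ z, z ≠ x → z ≠ y → H.signEntry z x = 0 ∧ H.signEntry z y = 0 := by
  classical
  have hφ := Real.goldenRatio_sq
  have hφ1 := Real.one_lt_goldenRatio
  have hφ2 := Real.goldenRatio_lt_two
  have hle := signEntry_sq_le h hxy
  have hy0 : 0 < (H.fatNbrs y).ncard := (Set.ncard_pos).2 (hfat y y.2)
  have hy2 := ncard_fatNbrs_le_two h y
  have habs : (1 : ℝ) ≤ (H.signEntry x y : ℝ) ^ 2 := by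
    exact_mod_cast (one_le_sq_iff_one_le_abs _).2 (Int.one_le_abs h0)
  have hy : (H.fatNbrs y).ncard = 1 := by
    by_contra hne
    have : (H.fatNbrs y).ncard = 2 := by omega
    -- Two fat neighbours at both vertices would give the bound (τ-1)² < 1 for the square of a
    -- nonzero integer.
    rw [hx, this] at hle
    push_cast at hle
    nlinarith
  rw [hx, hy] at hle
  push_cast at hle
  have hle1 : (H.signEntry x y : ℝ) ^ 2 ≤ 1 := by nlinarith
  have hval : H.signEntry x y = 1 ∨ H.signEntry x y = -1 := by
    rw [← mul_self_eq_one_iff, ← sq]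
    exact_mod_cast le_antisymm hle1 habs
  refine ⟨hy, hval, fun z hzx hzy => ?_⟩
  let _ := Fintype.ofFinite {x // x ∉ H.fat}
  set m : ℝ := (H.signEntry x y : ℝ) with hm
  have hm2 : m ^ 2 = 1 := le_antisymm hle1 habs
  -- The block on x, y has diagonal τ-1, τ and off-diagonal entry m with m² = 1, so (τ, -m) spans
  -- its kernel.
  set n : {x // x ∉ H.fat} → ℝ := Real.goldenRatio • Pi.single x 1 - m • Pi.single y 1 with hn
  have hMn : ∀ w, (H.shiftedB (-1 - Real.goldenRatio)).mulVec n w =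
      Real.goldenRatio * H.shiftedB (-1 - Real.goldenRatio) w x -
        m * H.shiftedB (-1 - Real.goldenRatio) w y := fun w => by
    simp [hn, Matrix.mulVec_sub, Matrix.mulVec_smul]
  -- For a positive semidefinite matrix, a zero of the quadratic form lies in the kernel; this
  -- brings in the rows of all other vertices.
  have hnull : (H.shiftedB (-1 - Real.goldenRatio)).mulVec n = 0 := by
    rw [← h.dotProduct_mulVec_zero_iff]
    simp only [hn, star_trivial, sub_dotProduct, smul_dotProduct, single_one_dotProduct,
      smul_eq_mul]
    rw [← hn, hMn, hMn, shiftedB_self, shiftedB_self, hx, hy, shiftedB_apply _ _ _ _ hxy,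
      shiftedB_apply _ _ _ _ hxy.symm, signEntry_comm H y x, ← hm]
    push_cast
    linear_combination Real.goldenRatio * hφ - Real.goldenRatio * hm2
  have h1 := hMn z
  rw [hnull, Pi.zero_apply, shiftedB_apply _ _ _ _ hzx, shiftedB_apply _ _ _ _ hzy, hm] at h1
  have h2 : H.signEntry z x = 0 := by
    by_contra hne
    -- Row z reads τ·s(z,x) = m·s(z,y), whose right side is an integer.
    refine (Real.goldenRatio_irrational.mul_intCast hne).ne_int
      (H.signEntry x y * H.signEntry z y) ?_
    push_cast
    linarith
  refine ⟨h2, ?_⟩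
  rw [h2, Int.cast_zero, mul_zero, zero_sub, eq_comm, neg_eq_zero] at h1
  exact_mod_cast (mul_eq_zero.1 h1).resolve_left (by exact_mod_cast h0)

/-- Here `f` is a class function, applied with the unique fat neighbour: a triangle -, -, + would
put the ends of its positive edge in one class. -/
lemma isSignSystem (h : (H.shiftedB (-1 - Real.goldenRatio)).PosSemidef)
    (hone : ∀ x, x ∉ H.fat → (H.fatNbrs x).ncard = 1)
    (hconn : ∀ X : Set {x // x ∉ H.fat}, X.Nonempty → X ≠ Set.univ →
      ∃ x ∈ X, ∃ y ∉ X, H.signEntry y x ≠ 0) (f : V → V)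
    (hneg : ∀ x y : {x // x ∉ H.fat}, H.signEntry x y = -1 → f x = f y)
    (hpos : ∀ x y : {x // x ∉ H.fat}, H.signEntry x y = 1 → f x ≠ f y) :
    IsSignSystem fun x y : {x // x ∉ H.fat} => H.signEntry x y := by
  classical
  let _ := Fintype.ofFinite {x // x ∉ H.fat}
  have hsign := fun x y : {x // x ∉ H.fat} => H.signEntry_cases (hone x x.2).le y
  refine ⟨fun x y => H.signEntry_comm x y, hsign, fun x y z => ?_, fun vs hvs xs _ => ?_, hconn⟩
  · by_contra hbad
    have h1 := hneg x y
    have h2 := hneg x z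
    have h3 := hneg y z
    have h4 := hpos x y
    have h5 := hpos x z
    have h6 := hpos y z
    rcases hsign x y with a | a | a <;> rcases hsign x z with b | b | b <;>
      rcases hsign y z with c | c | c <;> rw [a, b, c] at hbad <;>
      first | exact hbad (by decide) | skip
    · exact h4 a ((h2 b).trans (h3 c).symm)
    · exact h5 b ((h1 a).trans (h3 c))
    · exact h6 c ((h1 a).symm.trans (h2 b))
  · have hφ := Real.goldenRatio_sq
    have hφ1 := Real.one_lt_goldenRatio
    -- The second summand is nonnegative because τ < 13/8; it makes the diagonal equal to the
    -- integer 13.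
    set N : Matrix {x // x ∉ H.fat} {x // x ∉ H.fat} ℝ :=
      (8 : ℝ) • H.shiftedB (-1 - Real.goldenRatio) + (13 - 8 * Real.goldenRatio) • 1 with hN
    have hpsd : N.PosSemidef :=
      (h.smul (by norm_num)).add (Matrix.PosSemidef.one.smul (by nlinarith))
    have hoff : ∀ v w, v ≠ w → N v w = 8 * H.signEntry v w := fun v w hvw => by
      simp [hN, hvw, shiftedB_apply _ _ _ _ hvw]
    have hcast := cast_triForm N (fun x y : {x // x ∉ H.fat} => H.signEntry x y)
      (fun v w => by
        by_cases hvw : v = w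
        · rw [hvw]
        · rw [hoff v w hvw, hoff w v (Ne.symm hvw), signEntry_comm])
      (fun v => by
        simp [hN, shiftedB_self, hone v v.2]) hoff vs hvs xs
    have := hpsd.dotProduct_mulVec_nonneg (listVector vs xs)
    rw [star_trivial, ← hcast] at this
    exact_mod_cast this

theorem IsIrreducible.specialGraph_isomorphic (hfat : H.IsFat)
    (h : H.IsIrreducible (-1 - Real.goldenRatio)) [Nonempty {x // x ∉ H.fat}] :
    H.specialGraph.Isomorphic (EdgeSignedGraph.Q 0 0 1) ∨
      H.specialGraph.Isomorphic (EdgeSignedGraph.Q 1 0 1) ∨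
      H.specialGraph.Isomorphic (EdgeSignedGraph.Q 0 1 1) ∨
      ∃ T ∈ EdgeSignedGraph.exceptional, H.specialGraph.Isomorphic T.2 := by
  have hpsd := h.posSemidef
  have hconn := h.exists_signEntry_ne_zero
  have hcases : ∀ x : {x // x ∉ H.fat}, (H.fatNbrs x).ncard = 1 ∨ (H.fatNbrs x).ncard = 2 :=
    fun x => by
      have h1 := ncard_fatNbrs_le_two hpsd x
      have h2 : 0 < (H.fatNbrs x).ncard := (Set.ncard_pos).2 (hfat x x.2)
      omega
  by_cases htwo : ∃ x : {x // x ∉ H.fat}, (H.fatNbrs x).ncard = 2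
  · obtain ⟨x, hx⟩ := htwo
    by_cases hall : ∀ z, z = x
    · exact Or.inl (H.specialGraph.isomorphic_Q_one x hall)
    obtain ⟨x', rfl : x' = x, y, hy, hyx⟩ := hconn {x} (Set.singleton_nonempty x) fun he =>
      hall fun z => (Set.ext_iff.1 he z).2 trivial
    have hxy : x' ≠ y := fun e => hy e.symm
    rw [signEntry_comm] at hyx
    obtain ⟨hy1, hval, hz⟩ := signEntry_of_two hpsd hfat hxy hx hyx
    have hpair : ∀ z, z = x' ∨ z = y := by
      by_contra hno
      push Not at hno
      obtain ⟨z, hzx, hzy⟩ := hno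
      obtain ⟨a, ha, b, hb, hab⟩ := hconn {x', y} ⟨x', by simp⟩ fun he => by
        have : z ∈ ({x', y} : Set _) := he ▸ Set.mem_univ z
        simp [hzx, hzy] at this
      simp only [Set.mem_insert_iff, Set.mem_singleton_iff, not_or] at ha hb
      have := hz b hb.1 hb.2
      rcases ha with rfl | rfl
      · exact hab this.1
      · exact hab this.2
    have hadj := H.specialGraph_adj_iff hxy.symm hy1.le
    rw [signEntry_comm] at hadj
    rcases hval with hval | hval
    · exact Or.inr (Or.inl (H.specialGraph.isomorphic_Q_pos hpair (hadj.1.2 hval).symm))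
    · exact Or.inr (Or.inr (Or.inl (H.specialGraph.isomorphic_Q_neg hpair (hadj.2.2 hval).symm)))
  · have hone : ∀ x, x ∉ H.fat → (H.fatNbrs x).ncard = 1 := fun x hx =>
      (hcases ⟨x, hx⟩).resolve_right fun h2 => htwo ⟨_, h2⟩
    choose! f hf using fun x (hx : x ∉ H.fat) => Set.ncard_eq_one.1 (hone x hx)
    have hinter : ∀ x y : {x // x ∉ H.fat}, f x = f y ↔
        (H.fatNbrs x ∩ H.fatNbrs y).ncard = 1 := fun x y => by
      rw [hf x x.2, hf y y.2]
      constructor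
      · intro e
        rw [e, Set.inter_self, Set.ncard_singleton]
      · intro e
        obtain ⟨a, ha⟩ := Set.ncard_eq_one.1 e
        have : a ∈ ({f x} ∩ {f y} : Set V) := ha ▸ rfl
        exact this.1.symm.trans this.2
    have hneg : ∀ x y : {x // x ∉ H.fat}, H.signEntry x y = -1 → f x = f y := fun x y e => by
      have h1 : (H.fatNbrs x ∩ H.fatNbrs y).ncard ≤ 1 :=
        (Set.ncard_le_ncard Set.inter_subset_left).trans (hone x x.2).le
      rw [hinter]
      unfold signEntry at e
      split_ifs at e <;> omega
    have hpos : ∀ x y : {x // x ∉ H.fat}, H.signEntry x y = 1 → f x ≠ f y := fun x y e => by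
      rw [Ne, hinter]
      unfold signEntry at e
      split_ifs at e <;> omega
    refine EdgeSignedGraph.HasSigns.classification
      (fun x y hxy => H.specialGraph_adj_iff hxy (hone x x.2).le)
      (isSignSystem hpsd hone hconn f hneg hpos)
      (fun hp => h.2 (H.isReducible_of_isPendantClique hone hp)) (fun x => f x)
      (fun x y _ => hneg x y) fun x y _ => hpos x y

/-- A Hoffman graph with special graph `Q p q r`, where `2 ≤ r`, all of whose slim vertices have
one fat neighbour has the signs of a clique with pendant edges. -/
lemma isPendantClique_of_isomorphic_Q {p q r : ℕ} (hpq : p + q ≤ r) (hr : 2 ≤ r)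
    (hone : ∀ x, x ∉ H.fat → (H.fatNbrs x).ncard = 1)
    (h : H.specialGraph.Isomorphic (EdgeSignedGraph.Q p q r)) :
    IsPendantClique fun x y : {x // x ∉ H.fat} => H.signEntry x y := by
  obtain ⟨φ, hφ⟩ := h
  have hadj : ∀ a b, a ≠ b →
      ((EdgeSignedGraph.Q p q r).pos.Adj a b ↔ H.signEntry (φ.symm a) (φ.symm b) = 1) ∧
      ((EdgeSignedGraph.Q p q r).neg.Adj a b ↔ H.signEntry (φ.symm a) (φ.symm b) = -1) := by
    intro a b hab
    have h1 := hφ (φ.symm a) (φ.symm b)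
    have h2 := H.specialGraph_adj_iff (φ.symm.injective.ne hab) (hone _ (φ.symm a).2).le
    simp only [Equiv.apply_symm_apply] at h1
    exact ⟨h1.1.symm.trans h2.1, h1.2.symm.trans h2.2⟩
  -- Each pendant vertex goes to its point of attachment. The indices i < p and p + j never
  -- coincide, so no clique vertex receives two of them.
  set π : Fin p ⊕ Fin q ⊕ Fin r → Fin p ⊕ Fin q ⊕ Fin r := fun
    | .inl i => .inr (.inr ⟨i, by omega⟩)
    | .inr (.inl j) => .inr (.inr ⟨p + j, by omega⟩)
    | .inr (.inr k) => .inr (.inr k) with hπ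
  have hproj : IsPendantProjection (fun a b => H.signEntry (φ.symm a) (φ.symm b)) π := by
    refine ⟨?_, ?_, ?_, ?_, .inr (.inr ⟨0, by omega⟩), .inr (.inr ⟨1, by omega⟩), by simp, rfl, rfl⟩
    · rintro (i | i | i) <;> rfl
    · rintro (i | i | i) (j | j | j) hi hj hij <;> simp [hπ] at hi hj
      rw [← (hadj _ _ hij).1]
      have : i ≠ j := fun e => hij (by rw [e])
      simp [EdgeSignedGraph.Q, EdgeSignedGraph.QPos, this]
    · intro a b hab hne
      have hne' : a ≠ b := fun e => hne (by rw [e])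
      have h1 := (hadj a b hne').1
      have h2 := (hadj a b hne').2
      have h3 : ¬ (EdgeSignedGraph.Q p q r).pos.Adj a b ∧
          ¬ (EdgeSignedGraph.Q p q r).neg.Adj a b := by
        rcases a with i | i | i <;> rcases b with j | j | j <;>
          simp [EdgeSignedGraph.Q, EdgeSignedGraph.QPos, EdgeSignedGraph.QNeg, hπ,
            Fin.ext_iff] at hab hne ⊢ <;> omega
      rcases H.signEntry_cases (hone _ (φ.symm a).2).le (φ.symm b) with e | e | e
      · exact e
      · exact absurd (h1.2 e) h3.1
      · exact absurd (h2.2 e) h3.2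
    · rintro (i | i | i) (j | j | j) hi hj hij <;>
        simp [hπ, Fin.ext_iff] at hi hj hij ⊢ <;> omega
  exact hproj.transfer φ.symm fun _ _ _ => rfl

end irreducible

end HoffmanGraph

theorem mainTheorem5 {V : Type*} [Finite V] [Nonempty V] (H : HoffmanGraph V) :
    (H.IsFat → H.IsIrreducible (-1 - Real.goldenRatio) →
      H.specialGraph.Isomorphic (EdgeSignedGraph.Q 0 0 1) ∨
      H.specialGraph.Isomorphic (EdgeSignedGraph.Q 1 0 1) ∨
      H.specialGraph.Isomorphic (EdgeSignedGraph.Q 0 1 1) ∨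
      ∃ T ∈ EdgeSignedGraph.exceptional, H.specialGraph.Isomorphic T.2) ∧
    (∀ p q r : ℕ, p + q ≤ r → 2 ≤ r →
      (∀ x, x ∉ H.fat → (H.fatNbrs x).ncard = 1) →
      H.specialGraph.Isomorphic (EdgeSignedGraph.Q p q r) →
      H.IsReducible (-1 - Real.goldenRatio)) := by
  constructor
  · intro hfat hirr
    have : Nonempty {x // x ∉ H.fat} := by
      obtain ⟨x⟩ := ‹Nonempty V›
      by_cases hx : x ∈ H.fat
      · obtain ⟨y, hy, -⟩ := H.exists_slim_adj x hx
        exact ⟨⟨y, hy⟩⟩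
      · exact ⟨⟨x, hx⟩⟩
    exact hirr.specialGraph_isomorphic hfat
  · intro p q r hpq hr hone hiso
    exact H.isReducible_of_isPendantClique hone
      (HoffmanGraph.isPendantClique_of_isomorphic_Q hpq hr hone hiso)
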